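/- For $k>0$ let $K(r)=\frac{ik}{2r}H_1^{(1)}(kr)$, $r>0$, be the kernel of the half-space Dirichlet-to-Neumann map of the Helmholtz equation $\Delta u+k^2u=0$ in $\{y>0\}\subset\mathbb{R}^2$, where $H_1^{(1)}$ is the Hankel function of the first kind of order 1. Let $\alpha>\frac23$. There is a constant $C_\alpha>0$, depending only on $\alpha$, such that the following holds for all $C>0$, all $k\ge C$ and all integers $p\ge 1$. Put $r_0=C/k$ and $\tilde K=K\chi_{[r_0,1]}$, and let $\tilde K_p$ be a best approximation of $\tilde K$ in the uniform norm on $[r_0,1]$ from $$\mathrm{span}_{\mathbb{C}}\Big\{\frac{e^{ikr}}{r^{j/\alpha}} : j=1,\dots,p,\ r_0\le r\le 1\Big\}$$ (such a best approximation exists), extended by zero outside $[r_0,1]$. Let $\tilde D$ and $\tilde D_p$ be the integral operators with kernels $\tilde K(|x-x'|)$ and $\tilde K_p(|x-x'|)$, either on $L^2(\mathbb{R})$ or on $L^2([0,1])$. These operators are bounded and, in the operator norm, $$\|\tilde D-\tilde D_p\|\le C_\alpha\,p^{\,1-\lfloor 3\alpha/2\rfloor}\,\|\tilde K\|_\infty,\qquad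 \|\tilde K\|_\infty=\sup_{r_0\le r\le1}|K(r)|.$$ -/

import Mathlib

open MeasureTheory Set Filter Topology

/-- The Laplace-type integral `∫₀^∞ e^{-u} u^{1/2} (1 + iu/(2z))^{1/2} du`. -/
noncomputable def hankelLaplace (z : ℝ) : ℂ :=
  ∫ u in Ioi (0 : ℝ), ((Real.exp (-u) * √u : ℝ) : ℂ) * (1 + Complex.I * u / (2 * z)) ^ (1 / 2 : ℂ)

/-- The Hankel function of the first kind of order one, `H₁⁽¹⁾(z)`, for `z > 0`, given by the
classical integral
`H₁⁽¹⁾(z) = (2/(πz))^{1/2} e^{i(z - 3π/4)} / Γ(3/2) ∫₀^∞ e^{-u} u^{1/2} (1 + iu/(2z))^{1/2} du`.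
The theorems `hankelH1_bessel` and `hankelH1_asymptotic` below show that it is the solution on
`(0, ∞)` of the Bessel equation of order one with
`H₁⁽¹⁾(z) ~ (2/(πz))^{1/2} e^{i(z - 3π/4)}` as `z → ∞`, which is its defining property. -/
noncomputable def hankelH1 (z : ℝ) : ℂ :=
  (√(2 / (Real.pi * z)) : ℂ) * Complex.exp (Complex.I * (z - 3 * Real.pi / 4))
    / Real.Gamma (3 / 2) * hankelLaplace z

/-- The kernel `K(r) = (ik / 2r) H₁⁽¹⁾(kr)` of the half-space Dirichlet-to-Neumann map. -/
noncomputable def dtnKernel (k r : ℝ) : ℂ :=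
  Complex.I * k / (2 * r) * hankelH1 (k * r)

/-- The kernel cut off to `r₀ ≤ r ≤ 1` (and zero elsewhere). -/
noncomputable def truncatedKernel (k r₀ : ℝ) : ℝ → ℂ :=
  (Icc r₀ 1).indicator (dtnKernel k)

/-- The function `e^{ikr} / r^{j/α}` for `r₀ ≤ r ≤ 1` (and zero elsewhere). -/
noncomputable def basisFun (k α r₀ : ℝ) (j : ℕ) : ℝ → ℂ :=
  (Icc r₀ 1).indicator fun r =>
    Complex.exp (Complex.I * k * r) / ((r ^ ((j : ℝ) / α) : ℝ) : ℂ)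

/-- The complex span of the functions `e^{ikr} / r^{j/α}`, `j = 1, …, p`. -/
noncomputable def approxSpace (k α r₀ : ℝ) (p : ℕ) : Submodule ℂ (ℝ → ℂ) :=
  Submodule.span ℂ (basisFun k α r₀ '' Icc 1 p)

/-- The uniform norm `sup_r |f(r)|`, for bounded `f` (all functions it is used for are bounded,
see `truncatedKernel_bdd` and `approxSpace_bdd`). -/
noncomputable def uniformNorm (f : ℝ → ℂ) : ℝ := ⨆ r, ‖f r‖

/-- `g` is a best uniform approximation of `f` among the elements of `V`. -/
def IsBestUniformApprox (f : ℝ → ℂ) (V : Submodule ℂ (ℝ → ℂ)) (g : ℝ → ℂ) : Prop :=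
  g ∈ V ∧ ∀ h ∈ V, uniformNorm (f - g) ≤ uniformNorm (f - h)

/-- `T` is the bounded operator on `L²(Ω)` with integral kernel `κ(|x - y|)`:
`(T g)(x) = ∫_Ω κ(|x - y|) g(y) dy` for almost every `x ∈ Ω`. -/
def IsKernelOperator (Ω : Set ℝ) (κ : ℝ → ℂ)
    (T : Lp ℂ 2 (volume.restrict Ω) →L[ℂ] Lp ℂ 2 (volume.restrict Ω)) : Prop :=
  ∀ g : Lp ℂ 2 (volume.restrict Ω), ∀ᵐ x ∂(volume.restrict Ω),
    IntegrableOn (fun y => κ |x - y| * g y) Ω ∧ T g x = ∫ y in Ω, κ |x - y| * g y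

namespace HankelAux

lemma int0 (n : ℕ) : IntegrableOn (fun u : ℝ => Real.exp (-u) * √u * u ^ n) (Ioi 0) := by
  have h := Real.GammaIntegral_convergent (s := (n : ℝ) + 3 / 2) (by positivity)
  refine h.congr_fun (fun u hu => ?_) measurableSet_Ioi
  have hu : (0:ℝ) < u := hu
  simp only
  rw [Real.sqrt_eq_rpow, mul_assoc, ← Real.rpow_natCast, ← Real.rpow_add hu]
  congr 2; ring

lemma base_slit (z u : ℝ) : (1 + Complex.I * u / (2 * z)) ∈ Complex.slitPlane := by
  left
  have : (Complex.I * u / (2 * z)) = ((u / (2 * z) : ℝ) : ℂ) * Complex.I := by push_cast; ring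
  rw [this]; simp [-Complex.ofReal_div]

lemma base_norm (z u : ℝ) : 1 ≤ ‖(1 + Complex.I * u / (2 * z))‖ := by
  have : (Complex.I * u / (2 * z)) = ((u / (2 * z) : ℝ) : ℂ) * Complex.I := by push_cast; ring
  rw [this]
  calc (1:ℝ) = |(1 + ((u / (2 * z) : ℝ) : ℂ) * Complex.I).re| := by simp [-Complex.ofReal_div]
    _ ≤ _ := Complex.abs_re_le_norm _

lemma base_pow_le (z u c : ℝ) (hc : c ≤ 0) : ‖(1 + Complex.I * u / (2 * z)) ^ (c : ℂ)‖ ≤ 1 := by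
  rw [Complex.norm_cpow_real]
  exact Real.rpow_le_one_of_one_le_of_nonpos (base_norm z u) hc

lemma base_sqrt_le (z u : ℝ) (hz : 0 < z) (hu : 0 < u) :
    ‖(1 + Complex.I * u / (2 * z)) ^ ((1/2 : ℂ))‖ ≤ 1 + u / (2 * z) := by
  have : ((1/2 : ℂ)) = ((1/2 : ℝ) : ℂ) := by push_cast; ring
  rw [this, Complex.norm_cpow_real]
  calc _ ≤ ‖(1 + Complex.I * u / (2 * z))‖ ^ (1:ℝ) :=
        Real.rpow_le_rpow_of_exponent_le (base_norm z u) (by norm_num)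
    _ ≤ ‖(1:ℂ)‖ + ‖Complex.I * u / (2 * z)‖ := by rw [Real.rpow_one]; exact norm_add_le _ _
    _ = _ := by simp [abs_of_pos hz, abs_of_pos hu]

lemma base_deriv (c : ℂ) (z u : ℝ) (hz : z ≠ 0) :
    HasDerivAt (fun z : ℝ => (1 + Complex.I * u / (2 * z)) ^ c)
      (c * (1 + Complex.I * u / (2 * z)) ^ (c - 1) * (-(Complex.I * u / (2 * z ^ 2)))) z := by
  have hz' : (z : ℂ) ≠ 0 := by exact_mod_cast hz
  have h1 : HasDerivAt (fun w : ℂ => 1 + Complex.I * u / (2 * w))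
      (-(Complex.I * u / (2 * z ^ 2))) (z : ℂ) := by
    have := ((hasDerivAt_const (z:ℂ) (Complex.I * u)).fun_div
      ((hasDerivAt_id (z:ℂ)).const_mul (2:ℂ)) (by simpa using hz)).const_add 1
    refine this.congr_deriv ?_
    simp; field_simp
  exact (h1.cpow_const (base_slit z u)).comp_ofReal

lemma meas (c : ℂ) (z : ℝ) : Measurable (fun u : ℝ => (1 + Complex.I * u / (2 * z)) ^ c) :=
  Measurable.pow_const (by fun_prop) c

lemma lap_deriv (z : ℝ) (hz : 0 < z) :
    HasDerivAt hankelLaplace (∫ u in Ioi (0 : ℝ), ((Real.exp (-u) * √u : ℝ) : ℂ) *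
      ((1/2) * (1 + Complex.I * u / (2 * z)) ^ (1 / 2 - 1 : ℂ) *
        (-(Complex.I * u / (2 * z ^ 2))))) z := by
  refine (hasDerivAt_integral_of_dominated_loc_of_deriv_le (𝕜 := ℝ) (s := Ioi (z / 2))
    (F := fun z u : ℝ => ((Real.exp (-u) * √u : ℝ) : ℂ) *
      (1 + Complex.I * u / (2 * z)) ^ (1 / 2 : ℂ))
    (F' := fun z u : ℝ => ((Real.exp (-u) * √u : ℝ) : ℂ) *
      ((1/2) * (1 + Complex.I * u / (2 * z)) ^ (1 / 2 - 1 : ℂ) *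
        (-(Complex.I * u / (2 * z ^ 2)))))
    (bound := fun u => (2 / z ^ 2) * (Real.exp (-u) * √u * u ^ 1))
    (Ioi_mem_nhds (half_lt_self hz)) (Eventually.of_forall fun x => ?_) ?_ ?_ ?_
    ((int0 1).const_mul _) ?_).2
  · exact ((by fun_prop : Measurable fun u : ℝ =>
      ((Real.exp (-u) * √u : ℝ) : ℂ)).mul (meas _ _)).aestronglyMeasurable
  · refine Integrable.mono' ((int0 0).add ((int0 1).const_mul (1 / (2 * z))))
      ((by fun_prop : Measurable fun u : ℝ =>
      ((Real.exp (-u) * √u : ℝ) : ℂ)).mul (meas _ _)).aestronglyMeasurable ?_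
    filter_upwards [ae_restrict_mem measurableSet_Ioi] with u hu
    rw [norm_mul, Complex.norm_real, Real.norm_of_nonneg (by positivity)]
    refine (mul_le_mul_of_nonneg_left (base_sqrt_le z u hz hu) (by positivity)).trans (le_of_eq ?_)
    simp only [Pi.add_apply]; ring
  · exact ((by fun_prop : Measurable fun u : ℝ =>
      ((Real.exp (-u) * √u : ℝ) : ℂ)).mul (((meas _ _).const_mul _).mul (by fun_prop))).aestronglyMeasurable
  · filter_upwards [ae_restrict_mem measurableSet_Ioi] with u hu x hx
    have hu : 0 < u := hu
    have hx : z / 2 < x := hx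
    have hx0 : 0 < x := by linarith
    have h1 : ‖(1 + Complex.I * u / (2 * x)) ^ (1 / 2 - 1 : ℂ)‖ ≤ 1 := by
      have := base_pow_le x u (-1/2) (by norm_num)
      push_cast at this
      convert this using 3; norm_num
    have h2 : u / (2 * x ^ 2) ≤ 2 / z ^ 2 * u := by
      rw [div_le_iff₀ (by positivity)]
      have : z ^ 2 ≤ 4 * x ^ 2 := by nlinarith
      have h3 : 1 ≤ 2 / z ^ 2 * (2 * x ^ 2) := by
        rw [div_mul_eq_mul_div, le_div_iff₀ (by positivity)]; linarith
      nlinarith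
    have h4 : ‖(Complex.I * u / (2 * (x:ℂ) ^ 2))‖ = u / (2 * x ^ 2) := by
      simp [abs_of_pos hu]
    rw [norm_mul, Complex.norm_real, Real.norm_of_nonneg (by positivity), norm_mul, norm_mul,
      norm_neg, h4]
    have h5 : ‖(1/2 : ℂ)‖ ≤ 1 := by norm_num
    calc _ ≤ Real.exp (-u) * √u * (1 * 1 * (2 / z ^ 2 * u)) := by gcongr
      _ = _ := by ring
  · filter_upwards with u x hx
    have hx : z / 2 < x := hx
    exact (base_deriv _ x u (by linarith)).const_mul _

lemma lap_deriv2 (z : ℝ) (hz : 0 < z) :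
    Integrable (fun u : ℝ => ((Real.exp (-u) * √u : ℝ) : ℂ) *
      ((1/2) * ((1/2 - 1) * (1 + Complex.I * u / (2 * z)) ^ (1 / 2 - 1 - 1 : ℂ) *
        (-(Complex.I * u / (2 * z ^ 2)))) * (-(Complex.I * u / (2 * z ^ 2))) +
       (1/2) * (1 + Complex.I * u / (2 * z)) ^ (1 / 2 - 1 : ℂ) * (Complex.I * u / z ^ 3)))
       (volume.restrict (Ioi 0)) ∧
    HasDerivAt (fun z : ℝ => ∫ u in Ioi (0 : ℝ), ((Real.exp (-u) * √u : ℝ) : ℂ) *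
      ((1/2) * (1 + Complex.I * u / (2 * z)) ^ (1 / 2 - 1 : ℂ) *
        (-(Complex.I * u / (2 * z ^ 2)))))
     (∫ u in Ioi (0 : ℝ), ((Real.exp (-u) * √u : ℝ) : ℂ) *
      ((1/2) * ((1/2 - 1) * (1 + Complex.I * u / (2 * z)) ^ (1 / 2 - 1 - 1 : ℂ) *
        (-(Complex.I * u / (2 * z ^ 2)))) * (-(Complex.I * u / (2 * z ^ 2))) +
       (1/2) * (1 + Complex.I * u / (2 * z)) ^ (1 / 2 - 1 : ℂ) * (Complex.I * u / z ^ 3))) z := by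
  have hm : ∀ x : ℝ, AEStronglyMeasurable (fun u : ℝ => ((Real.exp (-u) * √u : ℝ) : ℂ) *
      ((1/2) * (1 + Complex.I * u / (2 * x)) ^ (1 / 2 - 1 : ℂ) *
        (-(Complex.I * u / (2 * x ^ 2))))) (volume.restrict (Ioi 0)) := fun x =>
    ((by fun_prop : Measurable fun u : ℝ =>
      ((Real.exp (-u) * √u : ℝ) : ℂ)).mul (((meas _ _).const_mul _).mul
        (by fun_prop))).aestronglyMeasurable
  have hp1 : ∀ x u : ℝ, ‖(1 + Complex.I * u / (2 * x)) ^ (1 / 2 - 1 : ℂ)‖ ≤ 1 := by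
    intro x u
    have := base_pow_le x u (-1/2) (by norm_num)
    push_cast at this
    convert this using 3; norm_num
  have hp2 : ∀ x u : ℝ, ‖(1 + Complex.I * u / (2 * x)) ^ (1 / 2 - 1 - 1 : ℂ)‖ ≤ 1 := by
    intro x u
    have := base_pow_le x u (-3/2) (by norm_num)
    push_cast at this
    convert this using 3; norm_num
  have hq : ∀ x u : ℝ, 0 < u → ‖(Complex.I * u / (2 * (x:ℂ) ^ 2))‖ = u / (2 * x ^ 2) := by
    intro x u hu; simp [abs_of_pos hu]
  have hq3 : ∀ x u : ℝ, 0 < x → 0 < u → ‖(Complex.I * u / ((x:ℂ) ^ 3))‖ = u / (x ^ 3) := by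
    intro x u hx hu; simp [abs_of_pos hu, abs_of_pos hx]
  have h5 : ‖(1/2 : ℂ)‖ ≤ 1 := by norm_num
  have h6 : ‖(1/2 - 1 : ℂ)‖ ≤ 1 := by norm_num
  refine hasDerivAt_integral_of_dominated_loc_of_deriv_le (𝕜 := ℝ) (s := Ioi (z / 2))
    (F := fun z u : ℝ => ((Real.exp (-u) * √u : ℝ) : ℂ) *
      ((1/2) * (1 + Complex.I * u / (2 * z)) ^ (1 / 2 - 1 : ℂ) *
        (-(Complex.I * u / (2 * z ^ 2)))))
    (F' := fun z u : ℝ => ((Real.exp (-u) * √u : ℝ) : ℂ) *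
      ((1/2) * ((1/2 - 1) * (1 + Complex.I * u / (2 * z)) ^ (1 / 2 - 1 - 1 : ℂ) *
        (-(Complex.I * u / (2 * z ^ 2)))) * (-(Complex.I * u / (2 * z ^ 2))) +
       (1/2) * (1 + Complex.I * u / (2 * z)) ^ (1 / 2 - 1 : ℂ) * (Complex.I * u / z ^ 3)))
    (bound := fun u => (2 / z ^ 2) ^ 2 * (Real.exp (-u) * √u * u ^ 2) +
      (8 / z ^ 3) * (Real.exp (-u) * √u * u ^ 1))
    (Ioi_mem_nhds (half_lt_self hz)) (Eventually.of_forall fun x => hm x) ?_ ?_ ?_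
    (((int0 2).const_mul _).add ((int0 1).const_mul _)) ?_
  · refine Integrable.mono' ((int0 1).const_mul (1 / (2 * z ^ 2))) (hm z) ?_
    filter_upwards [ae_restrict_mem measurableSet_Ioi] with u hu
    have hu : 0 < u := hu
    rw [norm_mul, Complex.norm_real, Real.norm_of_nonneg (by positivity), norm_mul, norm_mul,
      norm_neg, hq z u hu]
    calc _ ≤ Real.exp (-u) * √u * (1 * 1 * (u / (2 * z ^ 2))) := by gcongr; exact hp1 z u
      _ = _ := by ring
  · exact ((by fun_prop : Measurable fun u : ℝ => ((Real.exp (-u) * √u : ℝ) : ℂ)).mul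
      ((((((meas _ _).const_mul _).mul (by fun_prop)).const_mul _).mul (by fun_prop)).add
      (((meas _ _).const_mul _).mul (by fun_prop)))).aestronglyMeasurable
  · filter_upwards [ae_restrict_mem measurableSet_Ioi] with u hu x hx
    have hu : 0 < u := hu
    have hx : z / 2 < x := hx
    have hx0 : 0 < x := by linarith
    have h2 : u / (2 * x ^ 2) ≤ 2 / z ^ 2 * u := by
      have : (z/2) ^ 2 ≤ x ^ 2 := by gcongr
      calc u / (2 * x ^ 2) ≤ u / (2 * (z/2) ^ 2) := by gcongr
        _ = _ := by field_simp
    have h3 : u / x ^ 3 ≤ 8 / z ^ 3 * u := by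
      calc u / (x ^ 3) ≤ u / ((z/2) ^ 3) := by gcongr
        _ = _ := by field_simp; ring
    rw [norm_mul, Complex.norm_real, Real.norm_of_nonneg (by positivity)]
    calc _ ≤ Real.exp (-u) * √u * (1 * (1 * 1 * (2 / z ^ 2 * u)) * (2 / z ^ 2 * u)
          + 1 * 1 * (8 / z ^ 3 * u)) := by
          gcongr
          refine (norm_add_le _ _).trans (add_le_add ?_ ?_)
          · rw [norm_mul, norm_mul, norm_mul, norm_mul, norm_neg, hq x u hu]
            gcongr
            exact hp2 x u
          · rw [norm_mul, norm_mul, hq3 x u hx0 hu]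
            gcongr
            exact hp1 x u
      _ = _ := by ring
  · filter_upwards with u x hx
    have hx : z / 2 < x := hx
    have hx0 : x ≠ 0 := by linarith
    have hx' : (x : ℂ) ≠ 0 := by exact_mod_cast hx0
    have hd : HasDerivAt (fun x : ℝ => -(Complex.I * u / (2 * (x : ℂ) ^ 2)))
        (Complex.I * u / (x : ℂ) ^ 3) x := by
      have := (((hasDerivAt_const (x:ℂ) (Complex.I * u)).fun_div
        (((hasDerivAt_id (x:ℂ)).fun_pow 2).const_mul (2:ℂ)) (by simpa using hx0)).fun_neg).comp_ofReal
      refine this.congr_deriv ?_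
      simp; field_simp
    have := (((base_deriv (1/2 - 1) x u hx0).const_mul (1/2)).mul hd).const_mul
      (((Real.exp (-u) * √u : ℝ) : ℂ))
    refine this.congr_deriv ?_
    ring

noncomputable def lap1 (z : ℝ) : ℂ := ∫ u in Ioi (0 : ℝ), ((Real.exp (-u) * √u : ℝ) : ℂ) *
      ((1/2) * (1 + Complex.I * u / (2 * z)) ^ (1 / 2 - 1 : ℂ) *
        (-(Complex.I * u / (2 * z ^ 2))))

noncomputable def lap2 (z : ℝ) : ℂ := ∫ u in Ioi (0 : ℝ), ((Real.exp (-u) * √u : ℝ) : ℂ) *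
      ((1/2) * ((1/2 - 1) * (1 + Complex.I * u / (2 * z)) ^ (1 / 2 - 1 - 1 : ℂ) *
        (-(Complex.I * u / (2 * z ^ 2)))) * (-(Complex.I * u / (2 * z ^ 2))) +
       (1/2) * (1 + Complex.I * u / (2 * z)) ^ (1 / 2 - 1 : ℂ) * (Complex.I * u / z ^ 3))

lemma lap_int0 (z : ℝ) (hz : 0 < z) : Integrable (fun u : ℝ => ((Real.exp (-u) * √u : ℝ) : ℂ) *
      (1 + Complex.I * u / (2 * z)) ^ (1 / 2 : ℂ)) (volume.restrict (Ioi 0)) := by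
  refine Integrable.mono' ((int0 0).add ((int0 1).const_mul (1 / (2 * z))))
      ((by fun_prop : Measurable fun u : ℝ =>
      ((Real.exp (-u) * √u : ℝ) : ℂ)).mul (meas _ _)).aestronglyMeasurable ?_
  filter_upwards [ae_restrict_mem measurableSet_Ioi] with u hu
  rw [norm_mul, Complex.norm_real, Real.norm_of_nonneg (by positivity)]
  refine (mul_le_mul_of_nonneg_left (base_sqrt_le z u hz hu) (by positivity)).trans (le_of_eq ?_)
  simp only [Pi.add_apply]; ring

lemma lap_int1 (z : ℝ) : Integrable (fun u : ℝ => ((Real.exp (-u) * √u : ℝ) : ℂ) *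
      ((1/2) * (1 + Complex.I * u / (2 * z)) ^ (1 / 2 - 1 : ℂ) *
        (-(Complex.I * u / (2 * z ^ 2))))) (volume.restrict (Ioi 0)) := by
  refine Integrable.mono' ((int0 1).const_mul (1 / (2 * z ^ 2))) ((by fun_prop : Measurable fun u : ℝ =>
      ((Real.exp (-u) * √u : ℝ) : ℂ)).mul (((meas _ _).const_mul _).mul
        (by fun_prop))).aestronglyMeasurable ?_
  filter_upwards [ae_restrict_mem measurableSet_Ioi] with u hu
  have hu : 0 < u := hu
  have hp1 : ‖(1 + Complex.I * u / (2 * z)) ^ (1 / 2 - 1 : ℂ)‖ ≤ 1 := by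
    have := base_pow_le z u (-1/2) (by norm_num)
    push_cast at this
    convert this using 3; norm_num
  have hq : ‖(Complex.I * u / (2 * (z:ℂ) ^ 2))‖ = u / (2 * z ^ 2) := by
    simp [abs_of_pos hu]
  have h5 : ‖(1/2 : ℂ)‖ ≤ 1 := by norm_num
  rw [norm_mul, Complex.norm_real, Real.norm_of_nonneg (by positivity), norm_mul, norm_mul,
      norm_neg, hq]
  calc _ ≤ Real.exp (-u) * √u * (1 * 1 * (u / (2 * z ^ 2))) := by gcongr
    _ = _ := by ring

lemma lap_ode (z : ℝ) (hz : 0 < z) :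
    lap2 z + 2 * Complex.I * lap1 z - 3 / (4 * z ^ 2) * hankelLaplace z = 0 := by
  have hz' : (z : ℂ) ≠ 0 := by exact_mod_cast hz.ne'
  have i0 := (lap_int0 z hz).const_mul (3 / (4 * (z : ℂ) ^ 2))
  have i1 := (lap_int1 z).const_mul (2 * Complex.I)
  have i2 := (lap_deriv2 z hz).1
  have e := integral_sub' (i2.add i1) i0
  rw [integral_add' i2 i1, integral_const_mul, integral_const_mul] at e
  rw [lap2, lap1, hankelLaplace, ← e]
  have hint := (i2.add i1).sub i0
  rw [integral_Ioi_of_hasDerivAt_of_tendsto (m := 0)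
    (f := fun u : ℝ => ((Real.exp (-u) * (u * √u) : ℝ) : ℂ) *
      (-(1 / (2 * z ^ 2)) * (1 + Complex.I * u / (2 * z)) ^ (1 / 2 - 1 : ℂ))) ?_ ?_ hint ?_]
  · simp
  · apply ContinuousAt.continuousWithinAt
    refine ContinuousAt.mul (by fun_prop) (ContinuousAt.mul (by fun_prop) ?_)
    exact ContinuousAt.cpow (by fun_prop) continuousAt_const (base_slit z 0)
  · intro u hu
    have hu : 0 < u := hu
    have h1 : HasDerivAt (fun u : ℝ => Real.exp (-u) * (u * √u))
        (Real.exp (-u) * √u * (3 / 2 - u)) u := by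
      have := ((hasDerivAt_neg u).exp).mul ((hasDerivAt_id u).mul (Real.hasDerivAt_sqrt hu.ne'))
      refine this.congr_deriv ?_
      have h := Real.sq_sqrt hu.le
      have h0 : √u ≠ 0 := (Real.sqrt_pos.2 hu).ne'
      simp only [id]
      field_simp
      simp only [Pi.mul_apply, id]
      linear_combination -h
    have h2 : HasDerivAt (fun u : ℝ => (1 + Complex.I * u / (2 * z)) ^ (1 / 2 - 1 : ℂ))
        ((1 / 2 - 1) * (1 + Complex.I * u / (2 * z)) ^ (1 / 2 - 1 - 1 : ℂ) *
          (Complex.I / (2 * z))) u := by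
      have h3 : HasDerivAt (fun w : ℂ => 1 + Complex.I * w / (2 * z)) (Complex.I / (2 * z)) u := by
        have := (((hasDerivAt_id (u:ℂ)).const_mul Complex.I).div_const (2 * (z:ℂ))).const_add 1
        simpa using this
      exact (h3.cpow_const (base_slit z u)).comp_ofReal
    refine (h1.ofReal_comp.mul (h2.const_mul _)).congr_deriv ?_
    have hs : (1 + Complex.I * u / (2 * z)) ≠ 0 := Complex.slitPlane_ne_zero (base_slit z u)
    have e1 : (1 + Complex.I * u / (2 * z)) ^ (1 / 2 - 1 : ℂ) =
        (1 + Complex.I * u / (2 * z)) * (1 + Complex.I * u / (2 * z)) ^ (1 / 2 - 1 - 1 : ℂ) := by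
      rw [Complex.cpow_sub (1/2 - 1) 1 hs, Complex.cpow_one]
      generalize (1 + Complex.I * u / (2 * z)) = s at hs ⊢
      field_simp
    have e0 : (1 + Complex.I * u / (2 * z)) ^ (1 / 2 : ℂ) =
        (1 + Complex.I * u / (2 * z)) * (1 + Complex.I * u / (2 * z)) ^ (1 / 2 - 1 : ℂ) := by
      rw [Complex.cpow_sub (1/2) 1 hs, Complex.cpow_one]
      generalize (1 + Complex.I * u / (2 * z)) = s at hs ⊢
      field_simp
    simp only [Pi.sub_apply, Pi.add_apply]
    rw [e0, e1]
    generalize (1 + Complex.I * u / (2 * z)) ^ (1 / 2 - 1 - 1 : ℂ) = G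
    push_cast
    have hI := Complex.I_sq
    have hI3 : Complex.I ^ 3 = - Complex.I := by rw [pow_succ, hI]; ring
    have hI4 : Complex.I ^ 4 = 1 := Complex.I_pow_four
    field_simp
    ring_nf
    simp only [hI, hI3]
    ring
  · have hlim : Tendsto (fun u : ℝ => (1 / (2 * z ^ 2)) * (u ^ (3/2:ℝ) * Real.exp (-1 * u))) atTop (𝓝 0) := by
      have := (tendsto_rpow_mul_exp_neg_mul_atTop_nhds_zero (3/2) 1 one_pos).const_mul (1 / (2 * z ^ 2))
      rwa [mul_zero] at this
    refine squeeze_zero_norm' ?_ hlim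
    filter_upwards [eventually_gt_atTop 0] with u hu
    have hp1 : ‖(1 + Complex.I * u / (2 * z)) ^ (1 / 2 - 1 : ℂ)‖ ≤ 1 := by
      have := base_pow_le z u (-1/2) (by norm_num)
      push_cast at this
      convert this using 3; norm_num
    have hq : ‖-(1 / (2 * (z:ℂ) ^ 2))‖ = 1 / (2 * z ^ 2) := by simp
    rw [norm_mul, Complex.norm_real, Real.norm_of_nonneg (by positivity), norm_mul, hq]
    have h3 : u ^ (3/2:ℝ) = u * √u := by
      rw [Real.sqrt_eq_rpow, ← Real.rpow_one_add' hu.le (by norm_num)]; norm_num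
    rw [h3]
    calc _ ≤ Real.exp (-u) * (u * √u) * (1 / (2 * z ^ 2) * 1) := by gcongr
      _ = _ := by rw [neg_one_mul]; ring

noncomputable def pre (z : ℝ) : ℂ := (√(2 / (Real.pi * z)) : ℂ) * Complex.exp (Complex.I * (z - 3 * Real.pi / 4))
    / Real.Gamma (3 / 2)

lemma pre_deriv (z : ℝ) (hz : 0 < z) : HasDerivAt pre ((Complex.I - 1 / (2 * z)) * pre z) z := by
  have hz' : (z : ℂ) ≠ 0 := by exact_mod_cast hz.ne'
  have hp := Real.pi_pos
  have hpos : 0 < 2 / (Real.pi * z) := by positivity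
  have h1 : HasDerivAt (fun z : ℝ => √(2 / (Real.pi * z))) (-(1 / (2 * z)) * √(2 / (Real.pi * z))) z := by
    have := ((hasDerivAt_const z (2:ℝ)).fun_div ((hasDerivAt_id z).const_mul Real.pi)
      (mul_pos hp hz).ne').sqrt hpos.ne'
    refine this.congr_deriv ?_
    simp only [id]
    have hs := Real.sq_sqrt hpos.le
    have h0 : √(2 / (Real.pi * z)) ≠ 0 := (Real.sqrt_pos.2 hpos).ne'
    generalize √(2 / (Real.pi * z)) = q at hs h0
    field_simp at hs ⊢
    linear_combination hs
  have h2 : HasDerivAt (fun z : ℝ => Complex.exp (Complex.I * (z - 3 * Real.pi / 4)))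
      (Complex.exp (Complex.I * (z - 3 * Real.pi / 4)) * Complex.I) z := by
    have : HasDerivAt (fun w : ℂ => Complex.I * (w - 3 * Real.pi / 4)) Complex.I z := by
      simpa using ((hasDerivAt_id (z:ℂ)).sub_const (3 * Real.pi / 4 : ℂ)).const_mul Complex.I
    exact this.cexp.comp_ofReal
  refine ((h1.ofReal_comp.mul h2).div_const (Real.Gamma (3/2) : ℂ)).congr_deriv ?_
  rw [pre]; push_cast; ring

lemma hankel_deriv (z : ℝ) (hz : 0 < z) : HasDerivAt hankelH1
    (pre z * ((Complex.I - 1 / (2 * z)) * hankelLaplace z + lap1 z)) z := by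
  refine ((pre_deriv z hz).mul (lap_deriv z hz)).congr_deriv ?_
  rw [← lap1]; ring

end HankelAux

open HankelAux in
/-- The function `hankelH1` solves the Bessel equation of order one on `(0, ∞)`. -/
theorem hankelH1_bessel (z : ℝ) (hz : 0 < z) : DifferentiableAt ℝ hankelH1 z ∧
    DifferentiableAt ℝ (deriv hankelH1) z ∧
    (z : ℂ) ^ 2 * deriv (deriv hankelH1) z + z * deriv hankelH1 z +
      ((z : ℂ) ^ 2 - 1) * hankelH1 z = 0 := by
  have hz' : (z : ℂ) ≠ 0 := by exact_mod_cast hz.ne'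
  have hev : deriv hankelH1 =ᶠ[𝓝 z]
      fun z => pre z * ((Complex.I - 1 / (2 * z)) * hankelLaplace z + lap1 z) := by
    filter_upwards [Ioi_mem_nhds hz] with x hx
    exact (hankel_deriv x hx).deriv
  have hi : HasDerivAt (fun z : ℝ => Complex.I - 1 / (2 * (z:ℂ))) (1 / (2 * (z:ℂ) ^ 2)) z := by
    have := (((hasDerivAt_const (z:ℂ) (1:ℂ)).fun_div
        ((hasDerivAt_id (z:ℂ)).const_mul (2:ℂ)) (by simpa using hz.ne')).const_sub
          Complex.I).comp_ofReal
    refine this.congr_deriv ?_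
    simp; field_simp
  have h2 : HasDerivAt (deriv hankelH1) _ z :=
    ((pre_deriv z hz).mul ((hi.mul (lap_deriv z hz)).add (lap_deriv2 z hz).2)).congr_of_eventuallyEq hev
  refine ⟨(hankel_deriv z hz).differentiableAt, h2.differentiableAt, ?_⟩
  rw [h2.deriv, (hankel_deriv z hz).deriv, ← lap1, ← lap2]
  have ho := lap_ode z hz
  have : hankelH1 z = pre z * hankelLaplace z := rfl
  rw [this]
  have e : lap2 z = - 2 * Complex.I * lap1 z + 3 / (4 * z ^ 2) * hankelLaplace z := by
    linear_combination ho
  simp only [Pi.mul_apply, Pi.add_apply]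
  rw [show (∫ (a : ℝ) in Ioi 0, ((Real.exp (-a) * √a : ℝ) : ℂ) *
      ((1/2) * (1 + Complex.I * a / (2 * z)) ^ (1 / 2 - 1 : ℂ) *
        (-(Complex.I * a / (2 * z ^ 2))))) = lap1 z from rfl, e]
  have hI := Complex.I_sq
  field_simp
  linear_combination 16 * pre z * z ^ 2 * hankelLaplace z * hI

open HankelAux in
/-- As `z → ∞`, `hankelH1 z` is asymptotic to `(2/(πz))^{1/2} e^{i(z - 3π/4)}`. -/
theorem hankelH1_asymptotic : Tendsto (fun z : ℝ => hankelH1 z /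
    ((√(2 / (Real.pi * z)) : ℂ) * Complex.exp (Complex.I * (z - 3 * Real.pi / 4)))) atTop (𝓝 1) := by
  have hG : Real.Gamma (3/2) ≠ 0 := (Real.Gamma_pos_of_pos (by norm_num)).ne'
  have hL : Tendsto hankelLaplace atTop (𝓝 (Real.Gamma (3/2) : ℂ)) := by
    have hint : ((Real.Gamma (3/2) : ℝ) : ℂ) = ∫ u in Ioi (0:ℝ), ((Real.exp (-u) * √u : ℝ) : ℂ) := by
      rw [integral_complex_ofReal, Real.Gamma_eq_integral (by norm_num)]
      congr 1
      refine setIntegral_congr_fun measurableSet_Ioi fun u hu => ?_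
      rw [Real.sqrt_eq_rpow]; norm_num
    rw [hint]
    refine tendsto_integral_filter_of_dominated_convergence
      ((fun u => Real.exp (-u) * √u * u ^ 0) + fun u => Real.exp (-u) * √u * u ^ 1) (Eventually.of_forall fun x => ?_)
      ?_ ((int0 0).add (int0 1)) (Eventually.of_forall fun u => ?_)
    · exact ((by fun_prop : Measurable fun u : ℝ =>
        ((Real.exp (-u) * √u : ℝ) : ℂ)).mul (meas _ _)).aestronglyMeasurable
    · filter_upwards [eventually_ge_atTop (1:ℝ)] with z hz
      filter_upwards [ae_restrict_mem measurableSet_Ioi] with u hu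
      have hu : 0 < u := hu
      rw [norm_mul, Complex.norm_real, Real.norm_of_nonneg (by positivity)]
      have h1 := base_sqrt_le z u (by linarith) hu
      have h2 : u / (2 * z) ≤ u := div_le_self hu.le (by linarith)
      calc _ ≤ Real.exp (-u) * √u * (1 + u) := by gcongr; linarith
        _ = _ := by simp only [Pi.add_apply]; ring
    · have h0 : Tendsto (fun z : ℝ => 1 + Complex.I * u / (2 * z)) atTop (𝓝 1) := by
        have : Tendsto (fun z : ℝ => (((u / 2) / z : ℝ) : ℂ)) atTop (𝓝 ((0:ℝ):ℂ)) :=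
          (Complex.continuous_ofReal.tendsto 0).comp (tendsto_id.const_div_atTop (u/2))
        have := (this.const_mul Complex.I).const_add 1
        simp only [Complex.ofReal_zero, mul_zero, add_zero] at this
        refine this.congr fun z => ?_
        push_cast; ring
      have h1 : Tendsto (fun z : ℝ => (1 + Complex.I * u / (2 * z)) ^ (1/2 : ℂ)) atTop (𝓝 (1 ^ (1/2:ℂ))) :=
        ((continuousAt_cpow_const (by simp)).tendsto).comp h0
      simpa using h1.const_mul (((Real.exp (-u) * √u : ℝ) : ℂ))
  have hG' : ((Real.Gamma (3/2) : ℝ) : ℂ) ≠ 0 := by exact_mod_cast hG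
  have := hL.div_const ((Real.Gamma (3/2) : ℝ) : ℂ)
  rw [div_self hG'] at this
  refine this.congr' ?_
  filter_upwards [eventually_gt_atTop (0:ℝ)] with z hz
  have h0 : ((√(2 / (Real.pi * z)) : ℝ) : ℂ) ≠ 0 := by
    have := Real.pi_pos
    exact_mod_cast (Real.sqrt_pos.2 (by positivity : 0 < 2 / (Real.pi * z))).ne'
  have h1 := Complex.exp_ne_zero (Complex.I * (z - 3 * Real.pi / 4))
  rw [hankelH1]
  field_simp

theorem truncatedKernel_bdd (k r₀ : ℝ) (hk : 0 < k) (hr : 0 < r₀) :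
    BddAbove (range fun r => ‖truncatedKernel k r₀ r‖) := by
  have hc : ContinuousOn (dtnKernel k) (Icc r₀ 1) := by
    intro r hr'
    have hr0 : 0 < r := hr.trans_le hr'.1
    have h1 : ContinuousAt hankelH1 (k * r) :=
      (HankelAux.hankel_deriv (k * r) (by positivity)).continuousAt
    have h2 : ContinuousAt (fun r : ℝ => hankelH1 (k * r)) r :=
      ContinuousAt.comp (f := fun r : ℝ => k * r) h1 (by fun_prop)
    have h3 : (2 * (r : ℂ)) ≠ 0 := by simpa using hr0.ne'
    have h4 : ContinuousAt (fun r : ℝ => Complex.I * k / (2 * (r : ℂ))) r :=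
      ContinuousAt.div (by fun_prop) (by fun_prop) h3
    exact (h4.mul h2).continuousWithinAt
  obtain ⟨M, hM⟩ := isCompact_Icc.exists_bound_of_continuousOn hc
  refine ⟨max M 0, ?_⟩
  rintro _ ⟨r, rfl⟩
  by_cases h : r ∈ Icc r₀ 1
  · simp [truncatedKernel, h, hM r h]
  · simp [truncatedKernel, h]

theorem approxSpace_bdd (k α r₀ : ℝ) (p : ℕ) (hr : 0 < r₀) (f : ℝ → ℂ)
    (hf : f ∈ approxSpace k α r₀ p) : BddAbove (range fun r => ‖f r‖) := by
  suffices ∃ M, ∀ r, ‖f r‖ ≤ M by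
    obtain ⟨M, hM⟩ := this
    exact ⟨M, by rintro _ ⟨r, rfl⟩; exact hM r⟩
  induction hf using Submodule.span_induction with
  | mem x hx =>
    obtain ⟨j, -, rfl⟩ := hx
    have hc : ContinuousOn (fun r : ℝ =>
        Complex.exp (Complex.I * k * r) / ((r ^ ((j : ℝ) / α) : ℝ) : ℂ)) (Icc r₀ 1) := by
      intro r hr'
      have hr0 : 0 < r := hr.trans_le hr'.1
      have h1 : ((r ^ ((j : ℝ) / α) : ℝ) : ℂ) ≠ 0 := by
        exact_mod_cast (Real.rpow_pos_of_pos hr0 _).ne'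
      have h2 : ContinuousAt (fun r : ℝ => ((r ^ ((j : ℝ) / α) : ℝ) : ℂ)) r :=
        Complex.continuous_ofReal.continuousAt.comp
          (Real.continuousAt_rpow_const r _ (Or.inl hr0.ne'))
      exact (ContinuousAt.div (by fun_prop) h2 h1).continuousWithinAt
    obtain ⟨M, hM⟩ := isCompact_Icc.exists_bound_of_continuousOn hc
    refine ⟨max M 0, fun r => ?_⟩
    by_cases h : r ∈ Icc r₀ 1
    · rw [basisFun, indicator_of_mem h]
      exact (hM r h).trans (le_max_left _ _)
    · simp [basisFun, h]
  | zero => exact ⟨0, by simp⟩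
  | add x y _ _ hx hy =>
    obtain ⟨M, hM⟩ := hx
    obtain ⟨N, hN⟩ := hy
    exact ⟨M + N, fun r => (norm_add_le _ _).trans (add_le_add (hM r) (hN r))⟩
  | smul a x _ hx =>
    obtain ⟨M, hM⟩ := hx
    refine ⟨‖a‖ * M, fun r => ?_⟩
    rw [Pi.smul_apply, norm_smul]
    exact mul_le_mul_of_nonneg_left (hM r) (norm_nonneg a)

/-! The operator norm is controlled by the uniform norm of the kernel, so the problem reduces to
approximating `K` on `[r₀, 1]`. Write `L` for `hankelLaplace`. By its Laplace representation, `K(r)`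
is a constant times `r^(-3/2) e^{ikr} L(kr)`. Put `c = (r₀/r)^(1/(2α))`, which lies in `(0, 1]`.
Since `k r₀ = C`, the factor multiplying `e^{ikr}` becomes a constant times `c^(3α) L(C c^(-2α))`
(`dtnKernel_eq_profile`), while `r^(-j/α)` is a multiple of `c^(2j)`. What is needed is thus a
polynomial in `c²` without constant term that is close to this profile on `[0, 1]`.

Put `c = cos φ`. The profile becomes an even `π`-periodic function of `φ`, and truncating its
Fourier series amounts to a Chebyshev expansion in `2c² - 1`. The only singularity is at `c = 0`,
where the factor `c^(3α)` allows repeated integration by parts: the `n`-th coefficient is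
`O(|n|^(-j))` for every natural `j < 3α` (`exists_oscIntegral_bound`). With `m = ⌊3α/2⌋`, the choice
`j = m + 1` gives the truncation error `O(p^(1-m))` (`exists_polynomial_of_fourier_decay`). The
profile vanishes at `c = 0`, so removing the constant term at most doubles the error
(`exists_profile_approx`).

The constant must not depend on `C`, hence every bound is stated relative to `|L(C)|`.
Differentiation in `c` only replaces the integrand `(1 + iuy)^(1/2)` by itself times a polynomial in
`iuy/(1 + iuy)`, whose modulus is at most 1; and `(1 + iuy)^(1/2)` stays in a sector about the
positive axis, so the integral of its modulus is at most twice `|L(C)|` (`norm_polyLaplace_le`).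
Finally `|L(C)|` is, up to the same constant, `|K(r₀)| ≤ ‖K̃‖_∞`. -/

namespace HankelApprox

open Polynomial

/-! ### Modulus and argument of the square-root integrand -/

/-- The base `1 + iuy` of the square root in the Laplace integral. -/
noncomputable def base (u y : ℝ) : ℂ := 1 + Complex.I * u * y

/-- The bounded variable `iuy / (1 + iuy)`. -/
noncomputable def ratio (u y : ℝ) : ℂ := Complex.I * u * y / base u y

lemma base_eq (u y : ℝ) : base u y = 1 + ((u * y : ℝ) : ℂ) * Complex.I := by
  rw [base]; push_cast; ring

lemma base_re (u y : ℝ) : (base u y).re = 1 := by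
  rw [base_eq]; simp [-Complex.ofReal_mul]

lemma base_im (u y : ℝ) : (base u y).im = u * y := by
  rw [base_eq]; simp [-Complex.ofReal_mul]

lemma base_mem_slitPlane (u y : ℝ) : base u y ∈ Complex.slitPlane := by
  left; rw [base_re]; norm_num

lemma base_ne_zero (u y : ℝ) : base u y ≠ 0 := Complex.slitPlane_ne_zero (base_mem_slitPlane u y)

lemma one_le_norm_base (u y : ℝ) : 1 ≤ ‖base u y‖ := by
  calc (1 : ℝ) = |(base u y).re| := by simp [base_re]
    _ ≤ _ := Complex.abs_re_le_norm _

lemma norm_base_le (u y : ℝ) (hu : 0 ≤ u) (hy : 0 ≤ y) : ‖base u y‖ ≤ 1 + u * y := by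
  refine (norm_add_le _ _).trans ?_
  simp [abs_of_nonneg hu, abs_of_nonneg hy]

lemma norm_base_mono {u y y' : ℝ} (hu : 0 ≤ u) (hy : 0 ≤ y) (h : y ≤ y') :
    ‖base u y‖ ≤ ‖base u y'‖ := by
  rw [Complex.norm_def, Complex.norm_def]
  apply Real.sqrt_le_sqrt
  rw [Complex.normSq_apply, Complex.normSq_apply, base_re, base_re, base_im, base_im]
  have : u * y ≤ u * y' := by gcongr
  have h0 : 0 ≤ u * y := by positivity
  nlinarith

/-- The numerator is the imaginary part of the denominator times `i`. Consequently any polynomial in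
the ratio is bounded uniformly in `u` and `y`. -/
lemma norm_ratio_le (u y : ℝ) : ‖ratio u y‖ ≤ 1 := by
  have h0 : 0 < ‖base u y‖ := by linarith [one_le_norm_base u y]
  rw [ratio, norm_div, div_le_one h0]
  calc ‖Complex.I * u * y‖ = |(base u y).im| := by rw [base_im]; simp [abs_mul]
    _ ≤ _ := Complex.abs_im_le_norm _

lemma norm_base_sqrt (u y : ℝ) : ‖base u y ^ (1 / 2 : ℂ)‖ = ‖base u y‖ ^ (1 / 2 : ℝ) := by
  rw [show (1 / 2 : ℂ) = ((1 / 2 : ℝ) : ℂ) by push_cast; ring, Complex.norm_cpow_real]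

lemma norm_base_sqrt_le (u y : ℝ) (hu : 0 ≤ u) (hy : 0 ≤ y) :
    ‖base u y ^ (1 / 2 : ℂ)‖ ≤ 1 + u * y := by
  rw [norm_base_sqrt]
  calc _ ≤ ‖base u y‖ ^ (1 : ℝ) :=
        Real.rpow_le_rpow_of_exponent_le (one_le_norm_base u y) (by norm_num)
    _ ≤ _ := by rw [Real.rpow_one]; exact norm_base_le u y hu hy

/-- The base has positive real part, so its root has argument at most `π/4` in absolute value. The
cruder bound `π/3` is used because its cosine is exactly `1/2`. This excludes cancellation in the
Laplace integral. -/
lemma norm_base_sqrt_le_re (u y : ℝ) :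
    ‖base u y ^ (1 / 2 : ℂ)‖ ≤ 2 * (base u y ^ (1 / 2 : ℂ)).re := by
  rw [norm_base_sqrt, show (1 / 2 : ℂ) = ((1 / 2 : ℝ) : ℂ) by push_cast; ring,
    Complex.cpow_ofReal_re]
  have h1 : |(base u y).arg| ≤ Real.pi / 2 :=
    Complex.abs_arg_le_pi_div_two_iff.2 (by rw [base_re]; norm_num)
  have h2 : (1 / 2 : ℝ) ≤ Real.cos ((base u y).arg * (1 / 2)) := by
    rw [← Real.cos_abs ((base u y).arg * (1 / 2))]
    have h3 : |(base u y).arg * (1 / 2)| ≤ Real.pi / 3 := by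
      rw [abs_mul, abs_of_pos (by norm_num : (0:ℝ) < 1 / 2)]
      linarith [Real.pi_pos]
    calc (1 / 2 : ℝ) = Real.cos (Real.pi / 3) := Real.cos_pi_div_three.symm
      _ ≤ _ := Real.cos_le_cos_of_nonneg_of_le_pi (abs_nonneg _) (by linarith [Real.pi_pos]) h3
  have h4 : 0 ≤ ‖base u y‖ ^ (1 / 2 : ℝ) := by positivity
  nlinarith

lemma hasDerivAt_base (u y : ℝ) : HasDerivAt (base u) (Complex.I * u) y := by
  have := (((hasDerivAt_id (y : ℂ)).const_mul (Complex.I * u)).const_add 1).comp_ofReal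
  rw [mul_one] at this
  exact this

/-! ### Laplace integrals with a polynomial factor, and their derivatives -/

/-- The operator on polynomials that implements `y d/dy` under the Laplace integral. -/
noncomputable def eulerOp (Q : ℂ[X]) : ℂ[X] := C (1 / 2) * X * Q + X * (1 - X) * derivative Q

/-- With `b = 1 + iuy` and `v = (b - 1)/b`, the operator `y d/dy` sends `b^(1/2)` to `(1/2) v
b^(1/2)` and `v` to `v(1 - v)`. The class of integrands is therefore closed under differentiation.
-/
lemma hasDerivAt_integrand (Q : ℂ[X]) (u y : ℝ) (hy : y ≠ 0) :
    HasDerivAt (fun y => base u y ^ (1 / 2 : ℂ) * Q.eval (ratio u y))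
      ((y : ℂ)⁻¹ * (base u y ^ (1 / 2 : ℂ) * (eulerOp Q).eval (ratio u y))) y := by
  have hy' : (y : ℂ) ≠ 0 := by exact_mod_cast hy
  have hb := base_ne_zero u y
  have h1 : HasDerivAt (fun y => base u y ^ (1 / 2 : ℂ)) _ y :=
    (((hasDerivAt_id (base u y)).cpow_const (c := (1 / 2 : ℂ)) (base_mem_slitPlane u y)).comp y
      (hasDerivAt_base u y))
  have hn : HasDerivAt (fun y : ℝ => Complex.I * u * (y : ℂ)) (Complex.I * u) y := by
    simpa using ((hasDerivAt_id (y : ℂ)).const_mul (Complex.I * u)).comp_ofReal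
  have h2 : HasDerivAt (ratio u) _ y := hn.fun_div (hasDerivAt_base u y) hb
  have h3 : HasDerivAt (fun y => Q.eval (ratio u y)) _ y :=
    (Q.hasDerivAt (ratio u y)).comp y h2
  refine (h1.mul h3).congr_deriv ?_
  have e : Complex.I * u * y = base u y - 1 := by rw [base]; ring
  have e1 : Complex.I * u = (base u y - 1) / y := by rw [← e]; field_simp
  have e2 : ratio u y = (base u y - 1) / base u y := by rw [← e, ratio]
  have e3 : base u y ^ (1 / 2 - 1 : ℂ) = base u y ^ (1 / 2 : ℂ) / base u y := by
    rw [Complex.cpow_sub _ _ hb, Complex.cpow_one]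
  simp only [id, eulerOp, eval_add, eval_mul, eval_C, eval_X, eval_sub, eval_one, e3]
  generalize Q.eval (ratio u y) = q
  generalize (derivative Q).eval (ratio u y) = q'
  rw [e2, e1]
  generalize base u y ^ (1 / 2 : ℂ) = w
  generalize base u y = b at hb
  field_simp

/-- The Laplace integral of `(1 + iuy)^{1/2} Q(iuy / (1 + iuy))` against `e^{-u} u^{1/2}`. -/
noncomputable def polyLaplace (Q : ℂ[X]) (y : ℝ) : ℂ :=
  ∫ u in Ioi (0 : ℝ), ((Real.exp (-u) * √u : ℝ) : ℂ) *
    (base u y ^ (1 / 2 : ℂ) * Q.eval (ratio u y))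

lemma hankelLaplace_eq_polyLaplace (z : ℝ) : hankelLaplace z = polyLaplace 1 (1 / (2 * z)) := by
  rw [hankelLaplace, polyLaplace]
  refine integral_congr_ae (Eventually.of_forall fun u => ?_)
  simp only [eval_one, mul_one, base]
  congr 3
  push_cast; ring

lemma exists_norm_eval_le (Q : ℂ[X]) : ∃ B : ℝ, 0 < B ∧ ∀ v : ℂ, ‖v‖ ≤ 1 → ‖Q.eval v‖ ≤ B := by
  obtain ⟨B, hB⟩ := (isCompact_closedBall (0 : ℂ) 1).exists_bound_of_continuousOn
    Q.continuous.continuousOn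
  exact ⟨max B 1, by positivity, fun v hv => (hB v (by simpa using hv)).trans (le_max_left _ _)⟩

lemma measurable_integrand (Q : ℂ[X]) (y : ℝ) :
    Measurable fun u : ℝ => ((Real.exp (-u) * √u : ℝ) : ℂ) *
      (base u y ^ (1 / 2 : ℂ) * Q.eval (ratio u y)) := by
  have hb : Measurable fun u => base u y := by unfold base; fun_prop
  have hr : Measurable fun u => ratio u y := by
    unfold ratio; exact Measurable.div (by fun_prop) hb
  exact (by fun_prop : Measurable fun u : ℝ => ((Real.exp (-u) * √u : ℝ) : ℂ)).mul
    ((hb.pow_const _).mul (Q.continuous.measurable.comp hr))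

lemma norm_integrand_le {Q : ℂ[X]} {B : ℝ} (hQ : ∀ v : ℂ, ‖v‖ ≤ 1 → ‖Q.eval v‖ ≤ B) {u : ℝ}
    (y : ℝ) :
    ‖((Real.exp (-u) * √u : ℝ) : ℂ) * (base u y ^ (1 / 2 : ℂ) * Q.eval (ratio u y))‖ ≤
      B * (Real.exp (-u) * √u * ‖base u y ^ (1 / 2 : ℂ)‖) := by
  rw [norm_mul, norm_mul, Complex.norm_real, Real.norm_of_nonneg (by positivity)]
  calc _ ≤ Real.exp (-u) * √u * (‖base u y ^ (1 / 2 : ℂ)‖ * B) := by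
        gcongr; exact hQ _ (norm_ratio_le u y)
    _ = _ := by ring

lemma integrableOn_majorant (y : ℝ) :
    IntegrableOn (fun u : ℝ => Real.exp (-u) * √u * (1 + u * y)) (Ioi 0) := by
  refine ((HankelAux.int0 0).add ((HankelAux.int0 1).const_mul y)).congr
    (Eventually.of_forall fun u => ?_)
  simp only [Pi.add_apply]; ring

lemma integrableOn_norm_base (y : ℝ) (hy : 0 ≤ y) :
    IntegrableOn (fun u : ℝ => Real.exp (-u) * √u * ‖base u y ^ (1 / 2 : ℂ)‖) (Ioi 0) := by
  refine Integrable.mono' (integrableOn_majorant y) ?_ ?_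
  · have hb : Measurable fun u => base u y := by unfold base; fun_prop
    exact ((by fun_prop : Measurable fun u : ℝ => Real.exp (-u) * √u).mul
      (hb.pow_const _).norm).aestronglyMeasurable
  · filter_upwards [ae_restrict_mem measurableSet_Ioi] with u hu
    rw [Real.norm_of_nonneg (by positivity)]
    gcongr
    exact norm_base_sqrt_le u y (le_of_lt hu) hy

lemma integrableOn_integrand (Q : ℂ[X]) (y : ℝ) (hy : 0 ≤ y) :
    IntegrableOn (fun u : ℝ => ((Real.exp (-u) * √u : ℝ) : ℂ) *
      (base u y ^ (1 / 2 : ℂ) * Q.eval (ratio u y))) (Ioi 0) := by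
  obtain ⟨B, -, hB⟩ := exists_norm_eval_le Q
  exact Integrable.mono' ((integrableOn_norm_base y hy).const_mul B)
    (measurable_integrand Q y).aestronglyMeasurable
    (Eventually.of_forall fun u => norm_integrand_le hB y)

/-- `y d/dy` acts on the Laplace integrals through `eulerOp`. -/
lemma hasDerivAt_polyLaplace (Q : ℂ[X]) (y : ℝ) (hy : 0 < y) :
    HasDerivAt (polyLaplace Q) ((y : ℂ)⁻¹ * polyLaplace (eulerOp Q) y) y := by
  obtain ⟨B, hB0, hB⟩ := exists_norm_eval_le (eulerOp Q)
  have key := (hasDerivAt_integral_of_dominated_loc_of_deriv_le (𝕜 := ℝ)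
    -- The left end bounds the factor `1/x`, the right end bounds the growth of the square root.
    (μ := volume.restrict (Ioi (0 : ℝ))) (s := Ioo (y / 2) (2 * y)) (x₀ := y)
    (F := fun y u : ℝ => ((Real.exp (-u) * √u : ℝ) : ℂ) *
      (base u y ^ (1 / 2 : ℂ) * Q.eval (ratio u y)))
    (F' := fun y u : ℝ => (y : ℂ)⁻¹ * (((Real.exp (-u) * √u : ℝ) : ℂ) *
      (base u y ^ (1 / 2 : ℂ) * (eulerOp Q).eval (ratio u y))))
    (bound := fun u => (2 / y) * (B * (Real.exp (-u) * √u * (1 + u * (2 * y)))))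
    (Ioo_mem_nhds (by linarith) (by linarith))
    (Eventually.of_forall fun x => (measurable_integrand Q x).aestronglyMeasurable)
    (integrableOn_integrand Q y hy.le)
    ((measurable_integrand (eulerOp Q) y).const_mul _).aestronglyMeasurable ?_
    (((integrableOn_majorant (2 * y)).const_mul B).const_mul _) ?_).2
  · rwa [integral_const_mul] at key
  · filter_upwards [ae_restrict_mem measurableSet_Ioi] with u hu x hx
    have hu : 0 < u := hu
    have hx0 : 0 < x := by linarith [hx.1]
    rw [norm_mul, norm_inv, Complex.norm_real, Real.norm_of_nonneg hx0.le]
    gcongr ?_ * ?_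
    · rw [inv_eq_one_div, div_le_div_iff₀ hx0 hy]; linarith [hx.1]
    · refine (norm_integrand_le hB x).trans ?_
      gcongr
      refine (norm_base_sqrt_le u x hu.le hx0.le).trans ?_
      have := hx.2
      gcongr
  · filter_upwards with u x hx
    have hx0 : x ≠ 0 := by linarith [hx.1]
    refine ((hasDerivAt_integrand Q u x hx0).const_mul _).congr_deriv ?_
    ring

/-- The modulus of the base increases with `y`, so the worst case is `y = 1/(2z)`; there the
integrated modulus is at most twice the real part of `hankelLaplace z`. This is the source of
uniformity in `z`. -/
lemma norm_polyLaplace_le {Q : ℂ[X]} {B : ℝ} (hB0 : 0 ≤ B)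
    (hQ : ∀ v : ℂ, ‖v‖ ≤ 1 → ‖Q.eval v‖ ≤ B) {y z : ℝ} (hz : 0 < z) (hy : 0 ≤ y)
    (hyz : y ≤ 1 / (2 * z)) : ‖polyLaplace Q y‖ ≤ B * (2 * ‖hankelLaplace z‖) := by
  have hz' : 0 ≤ 1 / (2 * z) := by positivity
  have h1 : ‖polyLaplace Q y‖ ≤
      ∫ u in Ioi (0 : ℝ), B * (Real.exp (-u) * √u * ‖base u y ^ (1 / 2 : ℂ)‖) :=
    norm_integral_le_of_norm_le ((integrableOn_norm_base y hy).const_mul B)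
      (Eventually.of_forall fun u => norm_integrand_le hQ y)
  rw [integral_const_mul] at h1
  refine h1.trans (mul_le_mul_of_nonneg_left ?_ hB0)
  have hint := integrableOn_integrand 1 (1 / (2 * z)) hz'
  have h2 : (hankelLaplace z).re = ∫ u in Ioi (0 : ℝ), Real.exp (-u) * √u *
      (base u (1 / (2 * z)) ^ (1 / 2 : ℂ)).re := by
    rw [hankelLaplace_eq_polyLaplace, polyLaplace]
    have := integral_re hint
    simp only [RCLike.re_to_complex] at this
    rw [← this]
    refine integral_congr_ae (Eventually.of_forall fun u => ?_)
    simp only [eval_one, mul_one, Complex.re_ofReal_mul]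
  have h3 : IntegrableOn (fun u : ℝ => 2 * (Real.exp (-u) * √u *
      (base u (1 / (2 * z)) ^ (1 / 2 : ℂ)).re)) (Ioi 0) := by
    refine Integrable.const_mul (hint.re.congr (Eventually.of_forall fun u => ?_)) 2
    simp only [eval_one, mul_one, RCLike.re_to_complex, Complex.re_ofReal_mul]
  calc _ ≤ ∫ u in Ioi (0 : ℝ), 2 * (Real.exp (-u) * √u *
      (base u (1 / (2 * z)) ^ (1 / 2 : ℂ)).re) := by
        refine setIntegral_mono_on (integrableOn_norm_base y hy) h3 measurableSet_Ioi ?_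
        intro u hu
        have hu : 0 < u := hu
        calc _ ≤ Real.exp (-u) * √u * ‖base u (1 / (2 * z)) ^ (1 / 2 : ℂ)‖ := by
              rw [norm_base_sqrt, norm_base_sqrt]
              gcongr
              exact norm_base_mono hu.le hy hyz
          _ ≤ Real.exp (-u) * √u * (2 * (base u (1 / (2 * z)) ^ (1 / 2 : ℂ)).re) := by
              gcongr
              exact norm_base_sqrt_le_re _ _
          _ = _ := by ring
    _ = 2 * (hankelLaplace z).re := by rw [integral_const_mul, h2]
    _ ≤ _ := by gcongr; exact (le_abs_self _).trans (Complex.abs_re_le_norm _)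

/-! ### The rescaled kernel as a function of `c` -/

/-- The function `c^γ ∫ e^{-u} u^{1/2} (1 + iuy)^{1/2} Q(iuy / (1 + iuy)) du` with
`y = c^{2α} / (2z)`. -/
noncomputable def profile (α γ : ℝ) (Q : ℂ[X]) (z c : ℝ) : ℂ :=
  ((c ^ γ : ℝ) : ℂ) * polyLaplace Q (c ^ (2 * α) / (2 * z))

lemma norm_profile_le' {α γ : ℝ} (hα : 0 < α) {Q : ℂ[X]} {B : ℝ} (hB0 : 0 ≤ B)
    (hQ : ∀ v : ℂ, ‖v‖ ≤ 1 → ‖Q.eval v‖ ≤ B) {z c : ℝ} (hz : 0 < z) (hc : c ∈ Icc (0 : ℝ) 1) :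
    ‖profile α γ Q z c‖ ≤ c ^ γ * (B * (2 * ‖hankelLaplace z‖)) := by
  have h0 := hc.1
  rw [profile, norm_mul, Complex.norm_real, Real.norm_of_nonneg (by positivity)]
  gcongr
  refine norm_polyLaplace_le hB0 hQ hz (by positivity) ?_
  gcongr
  exact Real.rpow_le_one hc.1 hc.2 (by positivity)

lemma norm_profile_le {α γ : ℝ} (hα : 0 < α) (hγ : 0 ≤ γ) {Q : ℂ[X]} {B : ℝ} (hB0 : 0 ≤ B)
    (hQ : ∀ v : ℂ, ‖v‖ ≤ 1 → ‖Q.eval v‖ ≤ B) {z c : ℝ} (hz : 0 < z) (hc : c ∈ Icc (0 : ℝ) 1) :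
    ‖profile α γ Q z c‖ ≤ B * (2 * ‖hankelLaplace z‖) := by
  refine (norm_profile_le' hα hB0 hQ hz hc).trans (mul_le_of_le_one_left (by positivity) ?_)
  exact Real.rpow_le_one hc.1 hc.2 hγ

lemma profile_zero (α : ℝ) {γ : ℝ} (hγ : 0 < γ) (Q : ℂ[X]) (z : ℝ) : profile α γ Q z 0 = 0 := by
  simp [profile, Real.zero_rpow hγ.ne']

/-- Since `y` is proportional to `c^(2α)`, `c d/dc` acts on functions of `y` as `2α · y d/dy`. Each
derivative costs one power of `c` and nothing else. -/
lemma hasDerivAt_profile (α γ : ℝ) (Q : ℂ[X]) {z c : ℝ} (hz : 0 < z) (hc : 0 < c) :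
    HasDerivAt (profile α γ Q z)
      (γ * profile α (γ - 1) Q z c + 2 * α * profile α (γ - 1) (eulerOp Q) z c) c := by
  have hc' : (c : ℂ) ≠ 0 := by exact_mod_cast hc.ne'
  have hz' : (z : ℂ) ≠ 0 := by exact_mod_cast hz.ne'
  have h1 : HasDerivAt (fun c : ℝ => ((c ^ γ : ℝ) : ℂ)) ((γ * c ^ (γ - 1) : ℝ) : ℂ) c :=
    (Real.hasDerivAt_rpow_const (Or.inl hc.ne')).ofReal_comp
  have h2 : HasDerivAt (fun c : ℝ => c ^ (2 * α) / (2 * z))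
      (2 * α * c ^ (2 * α - 1) / (2 * z)) c :=
    (Real.hasDerivAt_rpow_const (Or.inl hc.ne')).div_const _
  have hy : 0 < c ^ (2 * α) / (2 * z) := by positivity
  have h3 : HasDerivAt (fun c : ℝ => polyLaplace Q (c ^ (2 * α) / (2 * z))) _ c :=
    HasDerivAt.scomp (g₁ := polyLaplace Q) c (hasDerivAt_polyLaplace Q _ hy) h2
  refine (h1.mul h3).congr_deriv ?_
  have hp : ((c ^ (2 * α) : ℝ) : ℂ) ≠ 0 := by
    exact_mod_cast (Real.rpow_pos_of_pos hc _).ne'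
  simp only [profile, Real.rpow_sub_one hc.ne', Complex.real_smul]
  push_cast
  field_simp

/-- At `c = 0` the Laplace factor stays bounded, so the positive power of `c` forces the limit 0. -/
lemma continuousOn_profile {α γ : ℝ} (hα : 0 < α) (hγ : 0 < γ) (Q : ℂ[X]) {z : ℝ} (hz : 0 < z) :
    ContinuousOn (profile α γ Q z) (Icc 0 1) := by
  intro c hc
  rcases hc.1.eq_or_lt with rfl | h
  · obtain ⟨B, hB0, hB⟩ := exists_norm_eval_le Q
    rw [ContinuousWithinAt, profile_zero α hγ]
    have hlim : Tendsto (fun c : ℝ => c ^ γ * (B * (2 * ‖hankelLaplace z‖))) (𝓝[Icc 0 1] 0)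
        (𝓝 0) := by
      have h1 : Tendsto (fun c : ℝ => c ^ γ) (𝓝[Icc 0 1] 0) (𝓝 (0 ^ γ)) :=
        (Real.continuousAt_rpow_const 0 γ (Or.inr hγ.le)).tendsto.mono_left nhdsWithin_le_nhds
      simpa [Real.zero_rpow hγ.ne'] using h1.mul_const (B * (2 * ‖hankelLaplace z‖))
    refine squeeze_zero_norm' ?_ hlim
    filter_upwards [self_mem_nhdsWithin] with c hc
    exact norm_profile_le' hα hB0.le hB hz hc
  · exact (hasDerivAt_profile α γ Q hz h).continuousAt.continuousWithinAt

/-! ### The angular variable and decay of Fourier integrals -/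

lemma cos_mem_Icc {φ : ℝ} (hφ : φ ∈ Icc (-(Real.pi / 2)) (Real.pi / 2)) :
    Real.cos φ ∈ Icc (0 : ℝ) 1 :=
  ⟨Real.cos_nonneg_of_mem_Icc hφ, Real.cos_le_one φ⟩

/-- The profile in the angular variable, times a power of the sine. -/
noncomputable def trigProfile (α γ : ℝ) (l : ℕ) (Q : ℂ[X]) (z φ : ℝ) : ℂ :=
  profile α γ Q z (Real.cos φ) * ((Real.sin φ ^ l : ℝ) : ℂ)

lemma continuousOn_trigProfile {α γ : ℝ} (hα : 0 < α) (hγ : 0 < γ) (l : ℕ) (Q : ℂ[X]) {z : ℝ}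
    (hz : 0 < z) :
    ContinuousOn (trigProfile α γ l Q z) (Icc (-(Real.pi / 2)) (Real.pi / 2)) := by
  refine ContinuousOn.mul ?_ (by fun_prop)
  exact (continuousOn_profile hα hγ Q hz).comp Real.continuous_cos.continuousOn
    fun φ hφ => cos_mem_Icc hφ

/-- The chain rule through the cosine adds a sine; differentiating the sine power yields a cosine,
absorbed into the exponent `γ + 1`. For `l = 0` the truncated `l - 1` is harmless because its
coefficient vanishes. -/
lemma hasDerivAt_trigProfile (α γ : ℝ) (l : ℕ) (Q : ℂ[X]) {z φ : ℝ} (hz : 0 < z)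
    (hφ : φ ∈ Ioo (-(Real.pi / 2)) (Real.pi / 2)) :
    HasDerivAt (trigProfile α γ l Q z)
      (-(γ * trigProfile α (γ - 1) (l + 1) Q z φ +
        2 * α * trigProfile α (γ - 1) (l + 1) (eulerOp Q) z φ -
        l * trigProfile α (γ + 1) (l - 1) Q z φ)) φ := by
  have hc : 0 < Real.cos φ := Real.cos_pos_of_mem_Ioo hφ
  have h1 : HasDerivAt (fun φ => profile α γ Q z (Real.cos φ)) _ φ :=
    HasDerivAt.scomp φ (hasDerivAt_profile α γ Q hz hc) (Real.hasDerivAt_cos φ)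
  have h2 : HasDerivAt (fun φ => ((Real.sin φ ^ l : ℝ) : ℂ)) _ φ :=
    ((Real.hasDerivAt_sin φ).fun_pow l).ofReal_comp
  refine (h1.mul h2).congr_deriv ?_
  have e : profile α (γ + 1) Q z (Real.cos φ) = Real.cos φ * profile α γ Q z (Real.cos φ) := by
    simp only [profile, Real.rpow_add_one hc.ne']
    push_cast; ring
  simp only [trigProfile, e, Complex.real_smul]
  push_cast
  ring

/-- The Fourier integrals of the angular profiles. -/
noncomputable def oscIntegral (α γ : ℝ) (l : ℕ) (Q : ℂ[X]) (z : ℝ) (n : ℤ) : ℂ :=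
  ∫ φ in -(Real.pi / 2)..(Real.pi / 2),
    trigProfile α γ l Q z φ * Complex.exp (2 * Complex.I * n * φ)

/-- The boundary terms vanish because the cosine does at `±π/2`. The condition `1 < γ` keeps the
exponent positive after differentiation, so the new integrands are continuous up to the endpoints.
-/
lemma oscIntegral_by_parts {α γ : ℝ} (hα : 0 < α) (hγ : 1 < γ) (l : ℕ) (Q : ℂ[X]) {z : ℝ}
    (hz : 0 < z) (n : ℤ) (hn : n ≠ 0) :
    2 * Complex.I * n * oscIntegral α γ l Q z n =
      γ * oscIntegral α (γ - 1) (l + 1) Q z n +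
        2 * α * oscIntegral α (γ - 1) (l + 1) (eulerOp Q) z n -
        l * oscIntegral α (γ + 1) (l - 1) Q z n := by
  have hpi := Real.pi_pos
  have hle : -(Real.pi / 2) ≤ Real.pi / 2 := by linarith
  have hk : (2 * Complex.I * n : ℂ) ≠ 0 := by
    simp [hn]
  have c1 := continuousOn_trigProfile hα (by linarith : 0 < γ - 1) (l + 1) Q hz
  have c2 := continuousOn_trigProfile hα (by linarith : 0 < γ - 1) (l + 1) (eulerOp Q) hz
  have c3 := continuousOn_trigProfile hα (by linarith : 0 < γ + 1) (l - 1) Q hz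
  have ce : Continuous fun φ : ℝ => Complex.exp (2 * Complex.I * n * φ) := by fun_prop
  have hv : ∀ φ : ℝ, HasDerivAt
      (fun φ : ℝ => Complex.exp (2 * Complex.I * n * φ) / (2 * Complex.I * n))
      (Complex.exp (2 * Complex.I * n * φ)) φ := by
    intro φ
    have h := ((((hasDerivAt_id (φ : ℂ)).const_mul (2 * Complex.I * n)).cexp).div_const
      (2 * Complex.I * n)).comp_ofReal
    refine h.congr_deriv ?_
    simp only [id]
    field_simp
  have ibp := intervalIntegral.integral_mul_deriv_eq_deriv_mul_of_hasDerivAt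
    (a := -(Real.pi / 2)) (b := Real.pi / 2) (u := trigProfile α γ l Q z)
    (v := fun φ : ℝ => Complex.exp (2 * Complex.I * n * φ) / (2 * Complex.I * n))
    (u' := fun φ => (-(γ * trigProfile α (γ - 1) (l + 1) Q z φ +
        2 * α * trigProfile α (γ - 1) (l + 1) (eulerOp Q) z φ -
        l * trigProfile α (γ + 1) (l - 1) Q z φ)))
    (v' := fun φ : ℝ => Complex.exp (2 * Complex.I * n * φ))
    (by rw [uIcc_of_le hle]; exact continuousOn_trigProfile hα (by linarith) l Q hz)
    (by fun_prop)
    (by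
      rw [min_eq_left hle, max_eq_right hle]
      intro φ hφ; exact hasDerivAt_trigProfile α γ l Q hz hφ)
    (fun φ _ => hv φ)
    (by
      refine ContinuousOn.intervalIntegrable ?_
      rw [uIcc_of_le hle]
      fun_prop)
    (ce.intervalIntegrable _ _)
  have b1 : trigProfile α γ l Q z (Real.pi / 2) = 0 := by
    simp [trigProfile, profile_zero α (by linarith : 0 < γ)]
  have b2 : trigProfile α γ l Q z (-(Real.pi / 2)) = 0 := by
    simp [trigProfile, profile_zero α (by linarith : 0 < γ)]
  have hi : ∀ {f : ℝ → ℂ}, ContinuousOn f (Icc (-(Real.pi / 2)) (Real.pi / 2)) →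
      IntervalIntegrable (fun φ => f φ * Complex.exp (2 * Complex.I * n * φ)) volume
        (-(Real.pi / 2)) (Real.pi / 2) := by
    intro f hf
    refine ContinuousOn.intervalIntegrable ?_
    rw [uIcc_of_le hle]
    exact hf.mul ce.continuousOn
  rw [b1, b2, zero_mul, zero_mul, sub_zero, zero_sub] at ibp
  rw [oscIntegral, ibp, oscIntegral, oscIntegral, oscIntegral,
    ← intervalIntegral.integral_const_mul, ← intervalIntegral.integral_const_mul,
    ← intervalIntegral.integral_const_mul,
    ← intervalIntegral.integral_add ((hi c1).const_mul _) ((hi c2).const_mul _),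
    ← intervalIntegral.integral_sub (((hi c1).const_mul _).add ((hi c2).const_mul _))
      ((hi c3).const_mul _), ← intervalIntegral.integral_neg,
    ← intervalIntegral.integral_const_mul]
  refine intervalIntegral.integral_congr fun φ _ => ?_
  field_simp

/-- The Fourier integrals decay like `|n|^{-j}` for `j < γ`, uniformly in `z`. -/
lemma exists_oscIntegral_bound {α : ℝ} (hα : 0 < α) (j : ℕ) :
    ∀ (γ : ℝ) (l : ℕ) (Q : ℂ[X]), (j : ℝ) < γ → ∃ A : ℝ, 0 ≤ A ∧ ∀ z : ℝ, 0 < z → ∀ n : ℤ,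
      ‖oscIntegral α γ l Q z n‖ * |(n : ℝ)| ^ j ≤ A * ‖hankelLaplace z‖ := by
  have hpi := Real.pi_pos
  have hle : -(Real.pi / 2) ≤ Real.pi / 2 := by linarith
  -- The exponents and the polynomial stay quantified inside, since one integration by parts changes
  -- all three; `γ` drops by at most 1 as `j` drops by 1.
  induction j with
  | zero =>
    intro γ l Q hγ
    obtain ⟨B, hB0, hB⟩ := exists_norm_eval_le Q
    refine ⟨B * 2 * Real.pi, by positivity, fun z hz n => ?_⟩
    have hγ : 0 ≤ γ := by simpa using hγ.le
    rw [pow_zero, mul_one]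
    have h := intervalIntegral.norm_integral_le_of_norm_le_const
      (a := -(Real.pi / 2)) (b := Real.pi / 2) (C := B * (2 * ‖hankelLaplace z‖))
      (f := fun φ : ℝ => trigProfile α γ l Q z φ * Complex.exp (2 * Complex.I * n * φ)) ?_
    · refine h.trans (le_of_eq ?_)
      rw [sub_neg_eq_add, add_halves, abs_of_pos hpi]; ring
    · intro φ hφ
      rw [uIoc_of_le hle] at hφ
      have h1 := norm_profile_le hα hγ hB0.le hB hz (cos_mem_Icc ⟨hφ.1.le, hφ.2⟩)
      have h2 : ‖Complex.exp (2 * Complex.I * n * φ)‖ = 1 := by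
        rw [show 2 * Complex.I * n * φ = ((2 * n * φ : ℝ) : ℂ) * Complex.I by push_cast; ring,
          Complex.norm_exp_ofReal_mul_I]
      rw [norm_mul, h2, mul_one, trigProfile, norm_mul, Complex.norm_real, norm_pow]
      refine (mul_le_of_le_one_right (norm_nonneg _) ?_).trans h1
      exact pow_le_one₀ (norm_nonneg _) (Real.abs_sin_le_one φ)
  | succ j ih =>
    intro γ l Q hγ
    push_cast at hγ
    have hj : (0 : ℝ) ≤ j := by positivity
    obtain ⟨A₁, hA₁, h₁⟩ := ih (γ - 1) (l + 1) Q (by linarith)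
    obtain ⟨A₂, hA₂, h₂⟩ := ih (γ - 1) (l + 1) (eulerOp Q) (by linarith)
    obtain ⟨A₃, hA₃, h₃⟩ := ih (γ + 1) (l - 1) Q (by linarith)
    have hγ0 : 0 ≤ γ := by linarith
    have hγ1 : 1 < γ := by linarith
    refine ⟨γ * A₁ + 2 * α * A₂ + l * A₃, by positivity, fun z hz n => ?_⟩
    rcases eq_or_ne n 0 with rfl | hn
    · simp; positivity
    have e := congrArg norm (oscIntegral_by_parts hα hγ1 l Q hz n hn)
    have e1 : ‖2 * Complex.I * n * oscIntegral α γ l Q z n‖ =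
        2 * (|(n : ℝ)| * ‖oscIntegral α γ l Q z n‖) := by
      rw [norm_mul, norm_mul, norm_mul, Complex.norm_I, Complex.norm_intCast]
      simp; ring
    have e2 : ∀ X Y Z : ℂ, ‖γ * X + 2 * α * Y - l * Z‖ ≤ γ * ‖X‖ + 2 * α * ‖Y‖ + l * ‖Z‖ := by
      intro X Y Z
      refine (norm_sub_le _ _).trans (add_le_add ((norm_add_le _ _).trans (add_le_add ?_ ?_)) ?_)
      · rw [norm_mul, Complex.norm_real, Real.norm_of_nonneg hγ0]
      · rw [norm_mul, norm_mul, Complex.norm_real, Real.norm_of_nonneg hα.le]; simp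
      · rw [norm_mul]; simp
    rw [e1] at e
    have e3 : |(n : ℝ)| * ‖oscIntegral α γ l Q z n‖ ≤ _ :=
      (le_mul_of_one_le_left (by positivity) one_le_two).trans (e.le.trans (e2 _ _ _))
    have h₁ := mul_le_mul_of_nonneg_left (h₁ z hz n) hγ0
    have h₂ := mul_le_mul_of_nonneg_left (h₂ z hz n) (by positivity : 0 ≤ 2 * α)
    have h₃ := mul_le_mul_of_nonneg_left (h₃ z hz n) (by positivity : (0 : ℝ) ≤ l)
    calc _ = |(n : ℝ)| * ‖oscIntegral α γ l Q z n‖ * |(n : ℝ)| ^ j := by ring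
      _ ≤ _ := mul_le_mul_of_nonneg_right e3 (by positivity)
      _ ≤ _ := by linarith

/-! ### Chebyshev approximation in `c²` -/

/-- Chebyshev approximation in `c²`: a continuous function of `c` whose angular Fourier
coefficients decay like `|n|^{-k-2}` is approximated to order `p^{-k}`. -/
lemma exists_polynomial_of_fourier_decay {G : ℝ → ℂ} (hG : ContinuousOn G (Icc 0 1)) {M : ℝ}
    (k : ℕ)
    (hM : ∀ n : ℤ, ‖∫ φ in -(Real.pi / 2)..(Real.pi / 2), G (Real.cos φ) *
      Complex.exp (2 * Complex.I * n * φ)‖ * |(n : ℝ)| ^ (k + 2) ≤ M) (p : ℕ) (hp : 1 ≤ p) :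
    ∃ q : ℂ[X], q.natDegree ≤ p ∧ ∀ c ∈ Icc (0 : ℝ) 1,
      ‖G c - q.eval ((c : ℂ) ^ 2)‖ ≤ M / (p : ℝ) ^ k * ∑' n : ℤ, 1 / (n : ℝ) ^ 2 := by
  have hpi := Real.pi_pos
  have : Fact (0 < Real.pi) := ⟨hpi⟩
  have hle : -(Real.pi / 2) ≤ Real.pi / 2 := by linarith
  -- The absolute value extends `G (cos φ)` from `[-π/2, π/2]` to a continuous function of period
  -- `π`.
  have hper : Function.Periodic (fun φ : ℝ => G |Real.cos φ|) Real.pi := by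
    intro φ; simp [Real.cos_add_pi]
  have hcont : Continuous fun φ : ℝ => G |Real.cos φ| :=
    hG.comp_continuous (by fun_prop) fun φ => ⟨abs_nonneg _, Real.abs_cos_le_one φ⟩
  let g : C(AddCircle Real.pi, ℂ) := ⟨hper.lift, continuous_coinduced_dom.mpr hcont⟩
  have hg : ∀ φ : ℝ, g (φ : AddCircle Real.pi) = G |Real.cos φ| := fun φ => rfl
  have hf : ∀ (n : ℤ) (φ : ℝ), fourier n (φ : AddCircle Real.pi) =
      Complex.exp (2 * Complex.I * n * φ) := by
    intro n φ
    rw [fourier_coe_apply]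
    congr 1
    have : (Real.pi : ℂ) ≠ 0 := by exact_mod_cast hpi.ne'
    field_simp
  have hcoef : ∀ n : ℤ, ‖fourierCoeff g n‖ * |(n : ℝ)| ^ (k + 2) ≤ M := by
    intro n
    rw [fourierCoeff_eq_intervalIntegral g n (-(Real.pi / 2)),
      show -(Real.pi / 2) + Real.pi = Real.pi / 2 by ring, norm_smul]
    have e : (∫ φ in -(Real.pi / 2)..(Real.pi / 2),
        fourier (-n) (φ : AddCircle Real.pi) • g (φ : AddCircle Real.pi)) =
        ∫ φ in -(Real.pi / 2)..(Real.pi / 2), G (Real.cos φ) *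
          Complex.exp (2 * Complex.I * (-n : ℤ) * φ) := by
      refine intervalIntegral.integral_congr fun φ hφ => ?_
      rw [uIcc_of_le hle] at hφ
      simp only [hf, hg, abs_of_nonneg (cos_mem_Icc hφ).1, smul_eq_mul]
      ring
    have h1 : ‖1 / Real.pi‖ ≤ 1 := by
      rw [Real.norm_of_nonneg (by positivity), div_le_one hpi]
      linarith [Real.pi_gt_three]
    rw [e]
    have := hM (-n)
    rw [show |((-n : ℤ) : ℝ)| = |(n : ℝ)| by simp] at this
    refine le_trans ?_ this
    gcongr
    exact mul_le_of_le_one_left (norm_nonneg _) h1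
  have hM0 : 0 ≤ M := le_trans (by positivity) (hcoef 0)
  have hsum0 : Summable fun n : ℤ => 1 / (n : ℝ) ^ 2 :=
    Real.summable_one_div_int_pow.2 one_lt_two
  have hdec : ∀ n : ℤ, n ≠ 0 → ‖fourierCoeff g n‖ ≤ M / |(n : ℝ)| ^ k * (1 / (n : ℝ) ^ 2) := by
    intro n hn
    have h0 : 0 < |(n : ℝ)| := abs_pos.2 (by exact_mod_cast hn)
    rw [← sq_abs (n : ℝ), div_mul_div_comm, mul_one, ← pow_add, le_div_iff₀ (by positivity)]
    exact hcoef n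
  have hsum : Summable (fourierCoeff g) := by
    refine Summable.of_norm_bounded_eventually (hsum0.mul_left M) ?_
    filter_upwards [(Set.finite_singleton (0 : ℤ)).compl_mem_cofinite] with n hn
    have hn : n ≠ 0 := hn
    refine (hdec n hn).trans ?_
    gcongr
    refine div_le_self hM0 (one_le_pow₀ ?_)
    exact_mod_cast Int.one_le_abs hn
  have hcos : ∀ φ : ℝ, HasSum (fun n : ℤ => fourierCoeff g n * Complex.cos (n * (2 * φ)))
      (G |Real.cos φ|) := by
    intro φ
    have h1 := has_pointwise_sum_fourier_series_of_summable hsum (φ : AddCircle Real.pi)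
    have h2 := has_pointwise_sum_fourier_series_of_summable hsum ((-φ : ℝ) : AddCircle Real.pi)
    rw [hg] at h1 h2
    rw [Real.cos_neg] at h2
    -- The function is even, so averaging the series at `φ` and `-φ` turns exponentials into
    -- cosines.
    have h3 := (h1.add h2).mul_left (1 / 2 : ℂ)
    rw [← two_mul, ← mul_assoc, one_div_mul_cancel two_ne_zero, one_mul] at h3
    refine h3.congr_fun fun n => ?_
    simp only [hf, smul_eq_mul, Complex.cos]
    push_cast
    ring_nf
  -- The symmetric partial sum: at `c = cos φ`, `T_n(2c² - 1) = cos(2nφ)`.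
  refine ⟨∑ n ∈ Finset.Icc (-(p : ℤ)) p, C (fourierCoeff g n) *
    (Polynomial.Chebyshev.T ℂ n).comp (C 2 * X - 1), ?_, ?_⟩
  · refine natDegree_sum_le_of_forall_le _ _ fun n hn => ?_
    refine (natDegree_C_mul_le _ _).trans (natDegree_comp_le.trans ?_)
    rw [Polynomial.Chebyshev.natDegree_T]
    have h1 : (C 2 * X - 1 : ℂ[X]).natDegree ≤ 1 := by compute_degree
    have h2 : n.natAbs ≤ p := by
      rw [Finset.mem_Icc] at hn; omega
    calc _ ≤ p * 1 := Nat.mul_le_mul h2 h1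
      _ = p := mul_one p
  · intro c hc
    have hφ : Real.cos (Real.arccos c) = c := Real.cos_arccos (by linarith [hc.1]) hc.2
    have h1 := hcos (Real.arccos c)
    rw [hφ, abs_of_nonneg hc.1] at h1
    have heval : (∑ n ∈ Finset.Icc (-(p : ℤ)) p, C (fourierCoeff g n) *
        (Polynomial.Chebyshev.T ℂ n).comp (C 2 * X - 1)).eval ((c : ℂ) ^ 2) =
        ∑ n ∈ Finset.Icc (-(p : ℤ)) p,
          fourierCoeff g n * Complex.cos (n * (2 * (Real.arccos c : ℝ))) := by
      rw [eval_finsetSum]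
      refine Finset.sum_congr rfl fun n _ => ?_
      rw [eval_mul, eval_C, eval_comp, ← Polynomial.Chebyshev.T_complex_cos, Complex.cos_two_mul,
        ← Complex.ofReal_cos, hφ]
      simp
    have h2 : HasSum (fun n : ℤ => if n ∈ Finset.Icc (-(p : ℤ)) p then
        fourierCoeff g n * Complex.cos (n * (2 * (Real.arccos c : ℝ))) else 0)
        (∑ n ∈ Finset.Icc (-(p : ℤ)) p,
          fourierCoeff g n * Complex.cos (n * (2 * (Real.arccos c : ℝ)))) := by
      rw [← Finset.sum_congr rfl fun n (hn : n ∈ Finset.Icc (-(p : ℤ)) p) => if_pos hn]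
      exact hasSum_sum_of_ne_finset_zero (s := Finset.Icc (-(p : ℤ)) p)
        (f := fun n : ℤ => if n ∈ Finset.Icc (-(p : ℤ)) p then
          fourierCoeff g n * Complex.cos (n * (2 * (Real.arccos c : ℝ))) else 0)
        fun n hn => if_neg hn
    rw [heval]
    -- Only terms beyond `p` survive. There `|n|^(-k-2)` is split into `|n|^(-k) ≤ p^(-k)` and the
    -- summable `n^(-2)`.
    refine (h1.sub h2).norm_le_of_bounded (hsum0.hasSum.mul_left (M / (p : ℝ) ^ k)) fun n => ?_
    split_ifs with hn
    · simp; positivity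
    · have hn' : (p : ℤ) ≤ |n| := by
        rw [Finset.mem_Icc] at hn; rcases abs_cases n with h | h <;> omega
      have hp' : (p : ℝ) ≤ |(n : ℝ)| := by exact_mod_cast hn'
      have hp0 : (0 : ℝ) < p := by exact_mod_cast hp
      have hn0 : n ≠ 0 := by
        rintro rfl; simp at hn'; omega
      have hcosle : ‖Complex.cos (n * (2 * (Real.arccos c : ℝ)))‖ ≤ 1 := by
        rw [show (n * (2 * (Real.arccos c : ℝ)) : ℂ) = ((n * (2 * Real.arccos c) : ℝ) : ℂ) by
          push_cast; ring, ← Complex.ofReal_cos, Complex.norm_real]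
        exact Real.abs_cos_le_one _
      rw [sub_zero, norm_mul]
      refine (mul_le_of_le_one_right (norm_nonneg _) hcosle).trans ((hdec n hn0).trans ?_)
      gcongr

/-- Uniform polynomial approximation of the rescaled kernel, with vanishing constant term. -/
lemma exists_profile_approx {α : ℝ} (hα : 2 / 3 < α) : ∃ A : ℝ, 0 < A ∧ ∀ z : ℝ, 0 < z →
    ∀ p : ℕ, 1 ≤ p → ∃ q : ℂ[X], q.natDegree ≤ p ∧ q.coeff 0 = 0 ∧ ∀ c ∈ Icc (0 : ℝ) 1,
      ‖profile α (3 * α) 1 z c - q.eval ((c : ℂ) ^ 2)‖ ≤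
        A * (p : ℝ) ^ (1 - ⌊3 * α / 2⌋) * ‖hankelLaplace z‖ := by
  have hα0 : 0 < α := by linarith
  have hm1 : 1 ≤ ⌊3 * α / 2⌋ := Int.le_floor.2 (by push_cast; linarith)
  have hm2 := Int.floor_le (3 * α / 2)
  obtain ⟨k, hk⟩ := Int.eq_ofNat_of_zero_le (by omega : 0 ≤ ⌊3 * α / 2⌋ - 1)
  have hm : ⌊3 * α / 2⌋ = k + 1 := by omega
  rw [hm] at hm2 ⊢
  push_cast at hm2
  have hk0 : (0 : ℝ) ≤ k := by positivity
  -- Here `k = ⌊3α/2⌋ - 1`. For `k = 0` this is exactly `α > 2/3`; for `k ≥ 1`, `k + 2 < 2(k + 1) ≤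
  -- 3α`.
  have hlt : ((k + 2 : ℕ) : ℝ) < 3 * α := by
    push_cast
    rcases Nat.eq_zero_or_pos k with rfl | h
    · push_cast; linarith
    · have : (1 : ℝ) ≤ k := by exact_mod_cast h
      linarith
  obtain ⟨A, hA0, hA⟩ := exists_oscIntegral_bound hα0 (k + 2) (3 * α) 0 1 hlt
  have hS : 0 ≤ ∑' n : ℤ, 1 / (n : ℝ) ^ 2 := tsum_nonneg fun n => by positivity
  refine ⟨2 * (A * ∑' n : ℤ, 1 / (n : ℝ) ^ 2) + 1, by positivity, fun z hz p hp => ?_⟩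
  obtain ⟨q, hq, hqa⟩ := exists_polynomial_of_fourier_decay
    (continuousOn_profile hα0 (by linarith : 0 < 3 * α) 1 hz) (M := A * ‖hankelLaplace z‖) k
    (fun n => by
      have := hA z hz n
      simpa only [oscIntegral, trigProfile, pow_zero, Complex.ofReal_one, mul_one] using this) p hp
  -- The profile is 0 at `c = 0`, so the constant term of `q` is itself bounded by the approximation
  -- error; this explains the factor 2.
  refine ⟨q - C (q.coeff 0), ?_, by simp, fun c hc => ?_⟩
  · exact (natDegree_sub_le _ _).trans (by simpa using hq)
  · have h0 := hqa 0 (by simp)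
    rw [profile_zero α (by linarith : 0 < 3 * α), zero_sub, norm_neg, Complex.ofReal_zero,
      zero_pow two_ne_zero, ← coeff_zero_eq_eval_zero] at h0
    have hpk : (p : ℝ) ^ (1 - ((k : ℤ) + 1)) = ((p : ℝ) ^ k)⁻¹ := by
      rw [show (1 - ((k : ℤ) + 1)) = -(k : ℤ) by ring, zpow_neg, zpow_natCast]
    rw [eval_sub, eval_C, hpk]
    calc _ = ‖(profile α (3 * α) 1 z c - q.eval ((c : ℂ) ^ 2)) + q.coeff 0‖ := by ring_nf
      _ ≤ _ := norm_add_le _ _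
      _ ≤ _ := add_le_add (hqa c hc) h0
      _ = 2 * (A * ∑' n : ℤ, 1 / (n : ℝ) ^ 2) * ((p : ℝ) ^ k)⁻¹ * ‖hankelLaplace z‖ := by
        ring
      _ ≤ _ := by gcongr; linarith

/-! ### Existence of best approximations -/

/-- Finite-dimensional spaces of bounded functions contain best uniform approximations. -/
lemma exists_isBestUniformApprox {f : ℝ → ℂ} (hf : BddAbove (range fun r => ‖f r‖))
    {V : Submodule ℂ (ℝ → ℂ)} [FiniteDimensional ℂ V]
    (hV : ∀ h ∈ V, BddAbove (range fun r => ‖h r‖)) : ∃ g, IsBestUniformApprox f V g := by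
  let F : lp (fun _ : ℝ => ℂ) ⊤ := ⟨f, memℓp_infty hf⟩
  let Φ : V →ₗ[ℂ] lp (fun _ : ℝ => ℂ) ⊤ :=
    { toFun := fun h => ⟨(h : ℝ → ℂ), memℓp_infty (hV h h.2)⟩
      map_add' := fun _ _ => rfl
      map_smul' := fun _ _ => rfl }
  have : ProperSpace (LinearMap.range Φ) := FiniteDimensional.proper ℂ _
  have hnorm : ∀ h : V, ‖F - Φ h‖ = uniformNorm (f - h) := fun h => lp.norm_eq_ciSup _
  -- The distance to `F` is continuous and coercive on a proper space, hence attains its minimum.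
  obtain ⟨⟨_, g, rfl⟩, hg⟩ := Continuous.exists_forall_le
    (f := fun w : LinearMap.range Φ => ‖F - w‖) (by fun_prop) (by
      refine tendsto_atTop_mono (f := fun w : LinearMap.range Φ => ‖w‖ - ‖F‖) (fun w => ?_)
        (tendsto_atTop_add_const_right _ _ (tendsto_norm_cocompact_atTop))
      have := norm_sub_norm_le (w : lp (fun _ : ℝ => ℂ) ⊤) F
      rw [norm_sub_rev]
      exact this)
  refine ⟨g, g.2, fun h hh => ?_⟩
  have := hg ⟨Φ ⟨h, hh⟩, ⟨h, hh⟩, rfl⟩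
  simpa only [hnorm] using this

lemma norm_le_uniformNorm {f : ℝ → ℂ} (hf : BddAbove (range fun r => ‖f r‖)) (r : ℝ) :
    ‖f r‖ ≤ uniformNorm f := le_ciSup hf r

/-! ### Bounded kernels of finite range as operators on `L²` -/

section Kernel

variable {κ : ℝ → ℂ} {M : NNReal}

/-- Cauchy–Schwarz on the window `[x - 1, x + 1]`, outside which the kernel vanishes; the 2 is the
length of the window. -/
lemma sq_lintegral_kernel_le (μ : Measure ℝ) (hμ : μ ≤ volume) (hM : ∀ r, ‖κ r‖ₑ ≤ M)
    (hs : ∀ r, 1 < r → κ r = 0) {g : ℝ → ℂ} (hg : Measurable g) (x : ℝ) :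
    (∫⁻ y, ‖κ |x - y| * g y‖ₑ ∂μ) ^ 2 ≤
      2 * M ^ 2 * ∫⁻ y, (Icc (x - 1) (x + 1)).indicator (fun y => ‖g y‖ₑ ^ 2) y ∂μ := by
  set B := Icc (x - 1) (x + 1)
  have hB : MeasurableSet B := measurableSet_Icc
  have hpt : ∀ y, ‖κ |x - y| * g y‖ₑ ≤
      (B.indicator (fun _ => (M : ENNReal)) * B.indicator fun y => ‖g y‖ₑ) y := by
    intro y
    by_cases hy : y ∈ B
    · simp only [Pi.mul_apply, indicator_of_mem hy, enorm_mul]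
      gcongr
      exact hM _
    · have : 1 < |x - y| := by
        by_contra! h
        rw [abs_le] at h
        exact hy ⟨by linarith [h.2], by linarith [h.1]⟩
      simp [hs _ this]
  have hvol : μ B ≤ 2 := by
    refine (hμ B).trans ?_
    rw [Real.volume_Icc, show x + 1 - (x - 1) = 2 by ring]
    simp
  have hcs := ENNReal.lintegral_mul_le_Lp_mul_Lq μ Real.HolderConjugate.two_two
    (f := B.indicator (fun _ => (M : ENNReal))) (g := B.indicator fun y => ‖g y‖ₑ)
    (measurable_const.indicator hB).aemeasurable (hg.enorm.indicator hB).aemeasurable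
  have e1 : ∫⁻ y, B.indicator (fun _ => (M : ENNReal)) y ^ (2 : ℝ) ∂μ ≤ 2 * M ^ 2 := by
    have : ∀ y, B.indicator (fun _ => (M : ENNReal)) y ^ (2 : ℝ) =
        B.indicator (fun _ => (M : ENNReal) ^ 2) y := by
      intro y; by_cases hy : y ∈ B <;> simp [hy]
    simp only [this]
    rw [lintegral_indicator_const hB, mul_comm]
    gcongr
  have e2 : ∀ y, B.indicator (fun y => ‖g y‖ₑ) y ^ (2 : ℝ) =
      B.indicator (fun y => ‖g y‖ₑ ^ 2) y := by
    intro y; by_cases hy : y ∈ B <;> simp [hy]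
  simp only [e2] at hcs
  have hsq : ∀ a : ENNReal, (a ^ (1 / 2 : ℝ)) ^ 2 = a := by
    intro a
    rw [← ENNReal.rpow_natCast, ← ENNReal.rpow_mul]; simp
  calc _ ≤ _ := pow_le_pow_left' ((lintegral_mono hpt).trans hcs) 2
    _ ≤ _ := by
      rw [mul_pow, hsq, hsq]
      gcongr

/-- Tonelli: a given `y` lies in the windows of a set of centres `x` of measure at most 2. -/
lemma lintegral_local_le (μ : Measure ℝ) [SFinite μ] (hμ : μ ≤ volume) {G : ℝ → ENNReal}
    (hG : Measurable G) :
    ∫⁻ x, ∫⁻ y, (Icc (x - 1) (x + 1)).indicator G y ∂μ ∂μ ≤ 2 * ∫⁻ y, G y ∂μ := by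
  have e : ∀ x y : ℝ, (Icc (x - 1) (x + 1)).indicator G y =
      (Icc (y - 1) (y + 1)).indicator (fun _ => G y) x := by
    intro x y
    have : y ∈ Icc (x - 1) (x + 1) ↔ x ∈ Icc (y - 1) (y + 1) := by
      simp only [mem_Icc]; constructor <;> rintro ⟨h1, h2⟩ <;> constructor <;> linarith
    by_cases h : y ∈ Icc (x - 1) (x + 1)
    · rw [indicator_of_mem h, indicator_of_mem (this.1 h)]
    · rw [indicator_of_notMem h, indicator_of_notMem (fun h' => h (this.2 h'))]
  have hm : Measurable (Function.uncurry fun x y : ℝ => (Icc (x - 1) (x + 1)).indicator G y) := by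
    have hset : MeasurableSet {z : ℝ × ℝ | z.2 ∈ Icc (z.1 - 1) (z.1 + 1)} := by
      refine MeasurableSet.inter ?_ ?_
      · exact measurableSet_le (f := fun z : ℝ × ℝ => z.1 - 1) (g := fun z => z.2)
          (by fun_prop) (by fun_prop)
      · exact measurableSet_le (f := fun z : ℝ × ℝ => z.2) (g := fun z => z.1 + 1)
          (by fun_prop) (by fun_prop)
    exact (hG.comp measurable_snd).indicator hset
  rw [lintegral_lintegral_swap hm.aemeasurable, ← lintegral_const_mul _ hG]
  refine lintegral_mono fun y => ?_
  simp only [e]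
  rw [lintegral_indicator_const measurableSet_Icc, mul_comm]
  gcongr
  refine (hμ _).trans ?_
  rw [Real.volume_Icc, show y + 1 - (y - 1) = 2 by ring]
  simp

/-- The two window estimates multiply to `2M² · 2 = (2M)²` for the squared norm. -/
lemma kernel_integrable_and_eLpNorm_le (μ : Measure ℝ) [SFinite μ] (hμ : μ ≤ volume)
    (hκ : Measurable κ) (hM : ∀ r, ‖κ r‖ₑ ≤ M) (hs : ∀ r, 1 < r → κ r = 0) {g : ℝ → ℂ}
    (hg : Measurable g) (hg2 : MemLp g 2 μ) :
    (∀ x, Integrable (fun y => κ |x - y| * g y) μ) ∧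
      eLpNorm (fun x => ∫ y, κ |x - y| * g y ∂μ) 2 μ ≤ 2 * M * eLpNorm g 2 μ := by
  have hsq : ∀ f : ℝ → ℂ, eLpNorm f 2 μ ^ 2 = ∫⁻ x, ‖f x‖ₑ ^ 2 ∂μ := by
    intro f
    have := eLpNorm_nnreal_pow_eq_lintegral (f := f) (μ := μ) (p := 2) two_ne_zero
    simpa using this
  have hfin : ∫⁻ y, ‖g y‖ₑ ^ 2 ∂μ < ⊤ := by
    rw [← hsq]; exact ENNReal.pow_lt_top hg2.eLpNorm_lt_top
  refine ⟨fun x => ⟨?_, ?_⟩, ?_⟩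
  · exact ((hκ.comp (by fun_prop)).mul hg).aestronglyMeasurable
  · have h := sq_lintegral_kernel_le μ hμ hM hs hg x
    have h2 : ∫⁻ y, (Icc (x - 1) (x + 1)).indicator (fun y => ‖g y‖ₑ ^ 2) y ∂μ < ⊤ :=
      (lintegral_mono fun y => indicator_le_self _ _ y).trans_lt hfin
    rw [HasFiniteIntegral]
    by_contra! htop
    rw [top_le_iff] at htop
    rw [htop] at h
    have : 2 * (M : ENNReal) ^ 2 * ∫⁻ y, (Icc (x - 1) (x + 1)).indicator
        (fun y => ‖g y‖ₑ ^ 2) y ∂μ < ⊤ :=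
      ENNReal.mul_lt_top (ENNReal.mul_lt_top (by simp) (ENNReal.pow_lt_top (by simp))) h2
    rw [ENNReal.top_pow two_ne_zero, top_le_iff] at h
    exact this.ne h
  · rw [← ENNReal.pow_le_pow_left_iff two_ne_zero, hsq, mul_pow, hsq]
    calc _ ≤ ∫⁻ x, 2 * M ^ 2 * ∫⁻ y, (Icc (x - 1) (x + 1)).indicator
            (fun y => ‖g y‖ₑ ^ 2) y ∂μ ∂μ := by
          refine lintegral_mono fun x => ?_
          refine le_trans ?_ (sq_lintegral_kernel_le μ hμ hM hs hg x)
          gcongr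
          exact enorm_integral_le_lintegral_enorm _
      _ = 2 * M ^ 2 * ∫⁻ x, ∫⁻ y, (Icc (x - 1) (x + 1)).indicator
            (fun y => ‖g y‖ₑ ^ 2) y ∂μ ∂μ :=
          lintegral_const_mul' _ _
            (ENNReal.mul_ne_top (by simp) (ENNReal.pow_ne_top (by simp)))
      _ ≤ 2 * M ^ 2 * (2 * ∫⁻ y, ‖g y‖ₑ ^ 2 ∂μ) := by
          gcongr
          exact lintegral_local_le μ hμ (hg.enorm.pow_const 2)
      _ = _ := by ring

/-- A bounded kernel supported in `[0, 1]` defines a bounded operator on `L²`. -/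
lemma exists_isKernelOperator (Ω : Set ℝ) (hκ : Measurable κ) {M : ℝ} (hM : ∀ r, ‖κ r‖ ≤ M)
    (hs : ∀ r, 1 < r → κ r = 0) : ∃ T, IsKernelOperator Ω κ T ∧ ‖T‖ ≤ 2 * M := by
  set μ := volume.restrict Ω
  have hμ : μ ≤ volume := Measure.restrict_le_self
  lift M to NNReal using (norm_nonneg _).trans (hM 0)
  have hM' : ∀ r, ‖κ r‖ₑ ≤ M := fun r => by
    rw [enorm_eq_nnnorm]; exact_mod_cast hM r
  have key := fun g : Lp ℂ 2 μ => kernel_integrable_and_eLpNorm_le μ hμ hκ hM' hs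
    (Lp.stronglyMeasurable g).measurable (Lp.memLp g)
  have hmeas : ∀ g : Lp ℂ 2 μ, AEStronglyMeasurable (fun x => ∫ y, κ |x - y| * g y ∂μ) μ := by
    intro g
    refine StronglyMeasurable.aestronglyMeasurable ?_
    refine StronglyMeasurable.integral_prod_right (f := fun x y => κ |x - y| * g y) ?_
    have hgm := (Lp.stronglyMeasurable g).measurable
    exact Measurable.stronglyMeasurable ((hκ.comp (by fun_prop)).mul (hgm.comp measurable_snd))
  have hLp : ∀ g : Lp ℂ 2 μ, MemLp (fun x => ∫ y, κ |x - y| * g y ∂μ) 2 μ := fun g =>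
    ⟨hmeas g, (key g).2.trans_lt (ENNReal.mul_lt_top (ENNReal.mul_lt_top (by simp) (by simp))
      (Lp.memLp g).eLpNorm_lt_top)⟩
  let L : Lp ℂ 2 μ →ₗ[ℂ] Lp ℂ 2 μ :=
    { toFun := fun g => (hLp g).toLp _
      map_add' := fun g h => by
        rw [← MemLp.toLp_add]
        refine MemLp.toLp_congr _ _ (Eventually.of_forall fun x => ?_)
        rw [Pi.add_apply, ← integral_add ((key g).1 x) ((key h).1 x)]
        refine integral_congr_ae ?_
        filter_upwards [Lp.coeFn_add g h] with y hy
        rw [hy, Pi.add_apply, mul_add]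
      map_smul' := fun a g => by
        rw [RingHom.id_apply, ← MemLp.toLp_const_smul]
        refine MemLp.toLp_congr _ _ (Eventually.of_forall fun x => ?_)
        rw [Pi.smul_apply, smul_eq_mul, ← integral_const_mul]
        refine integral_congr_ae ?_
        filter_upwards [Lp.coeFn_smul a g] with y hy
        rw [hy, Pi.smul_apply, smul_eq_mul, mul_left_comm] }
  have hL : ∀ g, ‖L g‖ ≤ 2 * M * ‖g‖ := by
    intro g
    change ‖(hLp g).toLp _‖ ≤ _
    rw [Lp.norm_toLp, Lp.norm_def]
    have h := ENNReal.toReal_mono (ENNReal.mul_ne_top (ENNReal.mul_ne_top (by simp) (by simp))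
      (Lp.memLp g).eLpNorm_ne_top) (key g).2
    simpa using h
  refine ⟨L.mkContinuous (2 * M) hL, fun g => ?_, L.mkContinuous_norm_le (by positivity) hL⟩
  filter_upwards [(hLp g).coeFn_toLp] with x hx
  exact ⟨(key g).1 x, hx⟩

lemma IsKernelOperator.sub {Ω : Set ℝ} {κ₁ κ₂ : ℝ → ℂ}
    {T₁ T₂ : Lp ℂ 2 (volume.restrict Ω) →L[ℂ] Lp ℂ 2 (volume.restrict Ω)}
    (h₁ : IsKernelOperator Ω κ₁ T₁) (h₂ : IsKernelOperator Ω κ₂ T₂) :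
    IsKernelOperator Ω (κ₁ - κ₂) (T₁ - T₂) := by
  intro g
  filter_upwards [h₁ g, h₂ g, Lp.coeFn_sub (T₁ g) (T₂ g)] with x hx₁ hx₂ hx
  simp only [Pi.sub_apply, sub_mul]
  refine ⟨hx₁.1.sub hx₂.1, ?_⟩
  rw [integral_sub hx₁.1 hx₂.1, ← hx₁.2, ← hx₂.2, sub_apply, hx, Pi.sub_apply]

end Kernel

/-! ### From profiles back to the Dirichlet-to-Neumann kernel -/

/-- The constant in `K(r) = A r^{-3/2} e^{ikr} ∫ e^{-u} u^{1/2} (1 + iu/(2kr))^{1/2} du`. -/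
noncomputable def amplitude (k : ℝ) : ℂ :=
  Complex.I * k / 2 * (√(2 / (Real.pi * k)) : ℂ) * Complex.exp (-(Complex.I * (3 * Real.pi / 4))) /
    Real.Gamma (3 / 2)

/-- With `r₀ = z/k` and `c = (r₀/r)^(1/(2α))`, one has `c^(3α) = (r₀/r)^(3/2)` and `c^(2α)/(2z) =
1/(2kr)`. The exponent `3α` thus encodes the amplitude `r^(-3/2)`. -/
lemma dtnKernel_eq_profile {α k z r : ℝ} (hα : 0 < α) (hk : 0 < k) (hz : 0 < z) (hr : 0 < r) :
    dtnKernel k r = amplitude k * (((z / k) ^ (-(3 / 2) : ℝ) : ℝ) : ℂ) *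
      Complex.exp (Complex.I * k * r) *
        profile α (3 * α) 1 z ((z / k / r) ^ (1 / (2 * α))) := by
  have hpi := Real.pi_pos
  have hq : 0 < z / k := by positivity
  have e1 : ((z / k / r) ^ (1 / (2 * α))) ^ (3 * α) = (z / k) ^ (3 / 2 : ℝ) / (r * √r) := by
    rw [← Real.rpow_mul (by positivity), show 1 / (2 * α) * (3 * α) = 3 / 2 by field_simp,
      Real.div_rpow hq.le hr.le, Real.sqrt_eq_rpow, ← Real.rpow_one_add' hr.le (by norm_num)]
    norm_num
  have e2 : ((z / k / r) ^ (1 / (2 * α))) ^ (2 * α) / (2 * z) = 1 / (2 * (k * r)) := by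
    rw [← Real.rpow_mul (by positivity), show 1 / (2 * α) * (2 * α) = 1 by field_simp,
      Real.rpow_one]
    field_simp
  have e3 : √(2 / (Real.pi * (k * r))) = √(2 / (Real.pi * k)) / √r := by
    rw [← Real.sqrt_div (by positivity), div_div, mul_assoc]
  have e4 : Complex.exp (Complex.I * (((k * r : ℝ) : ℂ) - 3 * Real.pi / 4)) =
      Complex.exp (Complex.I * k * r) * Complex.exp (-(Complex.I * (3 * Real.pi / 4))) := by
    rw [← Complex.exp_add]; push_cast; ring_nf
  have e5 : (z / k) ^ (3 / 2 : ℝ) ≠ 0 := (Real.rpow_pos_of_pos hq _).ne'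
  have e6 : √r ≠ 0 := (Real.sqrt_pos.2 hr).ne'
  have e7 : Real.Gamma (3 / 2) ≠ 0 := (Real.Gamma_pos_of_pos (by norm_num)).ne'
  rw [dtnKernel, hankelH1, profile, e1, e2,
    ← hankelLaplace_eq_polyLaplace, e3, e4, amplitude, Real.rpow_neg hq.le]
  push_cast
  have e5 : (((z / k) ^ (3 / 2 : ℝ) : ℝ) : ℂ) ≠ 0 := by exact_mod_cast e5
  have e6 : (√r : ℂ) ≠ 0 := by exact_mod_cast e6
  have e7 : (Real.Gamma (3 / 2) : ℂ) ≠ 0 := by exact_mod_cast e7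
  have e8 : (r : ℂ) ≠ 0 := by exact_mod_cast hr.ne'
  field_simp

lemma norm_dtnKernel_cutoff {k z : ℝ} (hk : 0 < k) (hz : 0 < z) :
    ‖dtnKernel k (z / k)‖ =
      ‖amplitude k * (((z / k) ^ (-(3 / 2) : ℝ) : ℝ) : ℂ)‖ * ‖hankelLaplace z‖ := by
  have hq : 0 < z / k := by positivity
  have h1 : ∀ x y : ℝ, ‖Complex.exp (Complex.I * x * y)‖ = 1 := fun x y => by
    rw [show Complex.I * x * y = ((x * y : ℝ) : ℂ) * Complex.I by push_cast; ring,
      Complex.norm_exp_ofReal_mul_I]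
  -- At the cutoff `c = 1`, so the value of `α` is immaterial and 1 is taken.
  rw [dtnKernel_eq_profile one_pos hk hz hq, norm_mul, norm_mul _ (Complex.exp _), h1, mul_one,
    div_self hq.ne', Real.one_rpow, profile, Real.one_rpow, Real.one_rpow, Complex.ofReal_one,
    one_mul, ← hankelLaplace_eq_polyLaplace]

lemma measurable_truncatedKernel {k r₀ : ℝ} (hk : 0 < k) (hr : 0 < r₀) :
    Measurable (truncatedKernel k r₀) := by
  have hc : ContinuousOn (dtnKernel k) (Icc r₀ 1) := by
    intro r hr'
    have hr0 : 0 < r := hr.trans_le hr'.1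
    have h1 : ContinuousAt hankelH1 (k * r) :=
      (HankelAux.hankel_deriv (k * r) (by positivity)).continuousAt
    have h2 : ContinuousAt (fun r : ℝ => hankelH1 (k * r)) r :=
      ContinuousAt.comp (f := fun r : ℝ => k * r) h1 (by fun_prop)
    have h3 : (2 * (r : ℂ)) ≠ 0 := by simpa using hr0.ne'
    have h4 : ContinuousAt (fun r : ℝ => Complex.I * k / (2 * (r : ℂ))) r :=
      ContinuousAt.div (by fun_prop) (by fun_prop) h3
    exact (h4.mul h2).continuousWithinAt
  classical
  rw [truncatedKernel, ← piecewise_eq_indicator]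
  exact hc.measurable_piecewise continuousOn_const measurableSet_Icc

lemma measurable_of_mem_approxSpace {k α r₀ : ℝ} {p : ℕ} {f : ℝ → ℂ}
    (hf : f ∈ approxSpace k α r₀ p) : Measurable f := by
  induction hf using Submodule.span_induction with
  | mem x hx =>
    obtain ⟨j, -, rfl⟩ := hx
    exact Measurable.indicator (by fun_prop) measurableSet_Icc
  | zero => exact measurable_const
  | add x y _ _ hx hy => exact hx.add hy
  | smul a x _ hx => exact hx.const_smul a

lemma eq_zero_of_mem_approxSpace {k α r₀ : ℝ} {p : ℕ} {f : ℝ → ℂ}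
    (hf : f ∈ approxSpace k α r₀ p) {r : ℝ} (hr : 1 < r) : f r = 0 := by
  have hn : r ∉ Icc r₀ 1 := fun h => absurd h.2 (not_le.2 hr)
  induction hf using Submodule.span_induction with
  | mem x hx =>
    obtain ⟨j, -, rfl⟩ := hx
    exact indicator_of_notMem hn _
  | zero => rfl
  | add x y _ _ hx hy => rw [Pi.add_apply, hx, hy, add_zero]
  | smul a x _ hx => rw [Pi.smul_apply, hx, smul_zero]

instance finiteDimensional_approxSpace (k α r₀ : ℝ) (p : ℕ) :
    FiniteDimensional ℂ (approxSpace k α r₀ p) :=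
  FiniteDimensional.span_of_finite ℂ ((finite_Icc 1 p).image _)

/-- The approximation space approximates the truncated kernel at the stated rate. -/
lemma exists_mem_approxSpace {α : ℝ} (hα : 2 / 3 < α) : ∃ A : ℝ, 0 < A ∧ ∀ C : ℝ, 0 < C →
    ∀ k : ℝ, C ≤ k → ∀ p : ℕ, 1 ≤ p → ∃ h ∈ approxSpace k α (C / k) p,
      uniformNorm (truncatedKernel k (C / k) - h) ≤
        A * (p : ℝ) ^ (1 - ⌊3 * α / 2⌋) * uniformNorm (truncatedKernel k (C / k)) := by
  have hα0 : 0 < α := by linarith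
  obtain ⟨A, hA0, hA⟩ := exists_profile_approx hα
  refine ⟨A, hA0, fun C hC k hCk p hp => ?_⟩
  have hk : 0 < k := hC.trans_le hCk
  have hr0 : 0 < C / k := by positivity
  have hr1 : C / k ≤ 1 := (div_le_one hk).2 hCk
  obtain ⟨q, hq, hq0, hqa⟩ := hA C hC p hp
  set W : ℂ := amplitude k * (((C / k) ^ (-(3 / 2) : ℝ) : ℝ) : ℂ) with hW
  -- The left side is `|K(r₀)|`, and `C ≤ k` puts `r₀` in `[r₀, 1]`. This converts the relative
  -- error into one measured by the sup norm.
  have hKle : ‖W‖ * ‖hankelLaplace C‖ ≤ uniformNorm (truncatedKernel k (C / k)) := by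
    rw [hW, ← norm_dtnKernel_cutoff hk hC]
    refine le_trans (le_of_eq ?_) (norm_le_uniformNorm (truncatedKernel_bdd k _ hk hr0) (C / k))
    rw [truncatedKernel, indicator_of_mem (show C / k ∈ Icc (C / k) 1 from ⟨le_rfl, hr1⟩)]
  -- The powers of `C / k` come from `c^(2j) = (r₀/r)^(j/α)`; the sum starts at 1 because `q` has no
  -- constant term.
  refine ⟨∑ j ∈ Finset.Icc 1 p, (W * q.coeff j * (((C / k) ^ ((j : ℝ) / α) : ℝ) : ℂ)) •
    basisFun k α (C / k) j, ?_, ?_⟩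
  · refine Submodule.sum_mem _ fun j hj => Submodule.smul_mem _ _ (Submodule.subset_span ?_)
    exact ⟨j, Finset.mem_Icc.1 hj, rfl⟩
  · have hp0 : (0 : ℝ) < p := by exact_mod_cast hp
    have hRpos : 0 ≤ A * (p : ℝ) ^ (1 - ⌊3 * α / 2⌋) := by positivity
    have hU : 0 ≤ uniformNorm (truncatedKernel k (C / k)) := Real.iSup_nonneg fun _ => norm_nonneg _
    refine ciSup_le fun r => ?_
    rw [Pi.sub_apply, Finset.sum_apply]
    by_cases hr : r ∈ Icc (C / k) 1
    · have hrpos : 0 < r := hr0.trans_le hr.1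
      set c : ℝ := (C / k / r) ^ (1 / (2 * α)) with hc
      have hle : C / k / r ≤ 1 := (div_le_one hrpos).2 hr.1
      have hcm : c ∈ Icc (0 : ℝ) 1 :=
        ⟨by positivity, Real.rpow_le_one (by positivity) hle (by positivity)⟩
      have hcj : ∀ j : ℕ, (c ^ 2) ^ j = (C / k) ^ ((j : ℝ) / α) / r ^ ((j : ℝ) / α) := by
        intro j
        rw [hc, ← pow_mul, ← Real.rpow_natCast, ← Real.rpow_mul (by positivity),
          ← Real.div_rpow hr0.le hrpos.le]
        congr 1
        push_cast
        field_simp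
      have heval : q.eval ((c : ℂ) ^ 2) = ∑ j ∈ Finset.Icc 1 p, q.coeff j * ((c : ℂ) ^ 2) ^ j := by
        rw [eval_eq_sum_range' (Nat.lt_succ_of_le hq), Finset.sum_range_succ', hq0, zero_mul,
          add_zero, Finset.range_eq_Ico, Finset.sum_Ico_add' (fun j => q.coeff j * ((c : ℂ) ^ 2) ^ j)]
        rfl
      have hsum : ∑ j ∈ Finset.Icc 1 p, ((W * q.coeff j *
          (((C / k) ^ ((j : ℝ) / α) : ℝ) : ℂ)) • basisFun k α (C / k) j) r =
          W * Complex.exp (Complex.I * k * r) * q.eval ((c : ℂ) ^ 2) := by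
        rw [heval, Finset.mul_sum]
        refine Finset.sum_congr rfl fun j _ => ?_
        rw [Pi.smul_apply, basisFun, indicator_of_mem hr, smul_eq_mul,
          show ((c : ℂ) ^ 2) ^ j = (((c ^ 2) ^ j : ℝ) : ℂ) by push_cast; rfl, hcj]
        push_cast
        ring
      rw [hsum, show truncatedKernel k (C / k) r = dtnKernel k r from indicator_of_mem hr _, dtnKernel_eq_profile hα0 hk hC hrpos, ← hW,
        ← hc, ← mul_sub, norm_mul, norm_mul,
        show Complex.I * k * r = ((k * r : ℝ) : ℂ) * Complex.I by push_cast; ring,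
        Complex.norm_exp_ofReal_mul_I, mul_one]
      calc _ ≤ ‖W‖ * (A * (p : ℝ) ^ (1 - ⌊3 * α / 2⌋) * ‖hankelLaplace C‖) := by
            gcongr; exact hqa c hcm
        _ = A * (p : ℝ) ^ (1 - ⌊3 * α / 2⌋) * (‖W‖ * ‖hankelLaplace C‖) := by ring
        _ ≤ _ := by gcongr
    · have : ∀ j ∈ Finset.Icc 1 p, ((W * q.coeff j *
          (((C / k) ^ ((j : ℝ) / α) : ℝ) : ℂ)) • basisFun k α (C / k) j) r = 0 := by
        intro j _
        rw [Pi.smul_apply, basisFun, indicator_of_notMem hr, smul_zero]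
      rw [Finset.sum_eq_zero this,
        show truncatedKernel k (C / k) r = 0 from indicator_of_notMem hr _, sub_zero, norm_zero]
      exact mul_nonneg hRpos hU

end HankelApprox

/-! ### The operator estimate -/

open HankelApprox in
theorem theorem1 (α : ℝ) (hα : 2 / 3 < α) :
    ∃ Cα : ℝ, 0 < Cα ∧
      ∀ (C : ℝ) (_ : 0 < C) (k : ℝ) (_ : C ≤ k) (p : ℕ) (_ : 1 ≤ p),
        (∃ Kp : ℝ → ℂ,
          IsBestUniformApprox (truncatedKernel k (C / k)) (approxSpace k α (C / k) p) Kp) ∧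
        ∀ Kp : ℝ → ℂ,
          IsBestUniformApprox (truncatedKernel k (C / k)) (approxSpace k α (C / k) p) Kp →
          ∀ Ω : Set ℝ, Ω = univ ∨ Ω = Icc 0 1 →
            ∃ D Dp : Lp ℂ 2 (volume.restrict Ω) →L[ℂ] Lp ℂ 2 (volume.restrict Ω),
              IsKernelOperator Ω (truncatedKernel k (C / k)) D ∧
              IsKernelOperator Ω Kp Dp ∧
              ‖D - Dp‖ ≤ Cα * (p : ℝ) ^ (1 - ⌊3 * α / 2⌋) *
                uniformNorm (truncatedKernel k (C / k)) := by
  obtain ⟨A, hA0, hA⟩ := exists_mem_approxSpace hα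
  refine ⟨2 * A, by positivity, fun C hC k hCk p hp => ?_⟩
  have hk : 0 < k := hC.trans_le hCk
  have hr0 : 0 < C / k := by positivity
  have hbdd := truncatedKernel_bdd k (C / k) hk hr0
  refine ⟨exists_isBestUniformApprox hbdd (approxSpace_bdd k α (C / k) p hr0), ?_⟩
  rintro Kp ⟨hKp, hbest⟩ Ω -
  obtain ⟨h, hh, hle⟩ := hA C hC k hCk p hp
  have hKm := measurable_truncatedKernel hk hr0
  have hK0 : ∀ r, 1 < r → truncatedKernel k (C / k) r = 0 := fun r hr =>
    indicator_of_notMem (fun h => absurd h.2 (not_le.2 hr)) _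
  have hbdd' : BddAbove (range fun r => ‖(truncatedKernel k (C / k) - Kp) r‖) := by
    obtain ⟨M, hM⟩ := hbdd
    obtain ⟨N, hN⟩ := approxSpace_bdd k α (C / k) p hr0 Kp hKp
    refine ⟨M + N, ?_⟩
    rintro _ ⟨r, rfl⟩
    exact (norm_sub_le _ _).trans (add_le_add (hM ⟨r, rfl⟩) (hN ⟨r, rfl⟩))
  obtain ⟨D, hD, -⟩ := exists_isKernelOperator Ω hKm (norm_le_uniformNorm hbdd) hK0
  obtain ⟨E, hE, hEn⟩ := exists_isKernelOperator Ω
    (hKm.sub (measurable_of_mem_approxSpace hKp)) (norm_le_uniformNorm hbdd') fun r hr => by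
      rw [Pi.sub_apply, hK0 r hr, eq_zero_of_mem_approxSpace hKp hr, sub_zero]
  -- `E` has kernel `K̃ - K̃_p`, so defining the second operator as `D - E` makes the difference
  -- equal to `E`, whose norm is already bounded.
  refine ⟨D, D - E, hD, by simpa using hD.sub hE, ?_⟩
  rw [sub_sub_cancel]
  calc ‖E‖ ≤ 2 * uniformNorm (truncatedKernel k (C / k) - Kp) := hEn
    _ ≤ 2 * (A * (p : ℝ) ^ (1 - ⌊3 * α / 2⌋) * uniformNorm (truncatedKernel k (C / k))) := by
        gcongr
        exact (hbest h hh).trans hle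
    _ = _ := by ring
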